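/- Let $z,u,y,t,p_1,p_2,\ldots,q_1,q_2,\ldots$ be indeterminates. For a partition $\alpha\vdash d$ ($d\ge 0$) let $l(\alpha)$ be its number of parts, $|\operatorname{Aut}\alpha|=\prod_{i\ge1}a_i!$ where $a_i$ is the number of parts equal to $i$, and $p_\alpha=\prod_i p_{\alpha_i}$, $q_\alpha=\prod_i q_{\alpha_i}$. **Hurwitz numbers.** For $\alpha,\beta\vdash d$ and $g\in\mathbb Z$ put $r=r^g_{\alpha,\beta}=-2+2g+l(\alpha)+l(\beta)$. Consider the tuples $(\sigma,\tau_1,\ldots,\tau_r,\gamma)$ of permutations of $\{1,\ldots,d\}$ such that $\sigma$ has cycle type $\beta$, $\gamma$ has cycle type $\alpha$, the $\tau_i$ are transpositions, and $\tau_r\cdots\tau_1\sigma=\gamma$. The possibly disconnected double Hurwitz number $\tilde H^g_{\alpha,\beta}$ is $|\operatorname{Aut}\alpha|\,|\operatorname{Aut}\beta|/d!$ times the number of such tuples. The (connected) double Hurwitz number $H^g_{\alpha,\beta}$ is $|\operatorname{Aut}\alpha|\,|\operatorname{Aut}\beta|/d!$ times the number of such tuples for which $\sigma,\tau_1,\ldots,\tau_r$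 generate a group acting transitively on $\{1,\ldots,d\}$. Both are $0$ if $r<0$. Their generating series are $$H=\sum_{g\ge0}\ \sum_{d\ge1}\ \sum_{\alpha,\beta\vdash d}y^gz^d\,p_\alpha q_\beta\,u^{l(\beta)}\frac{H^g_{\alpha,\beta}}{r^g_{\alpha,\beta}!\,|\operatorname{Aut}\alpha|\,|\operatorname{Aut}\beta|},$$ $$\tilde H=\sum_{g\in\mathbb Z}\ \sum_{d\ge0}\ \sum_{\alpha,\beta\vdash d}y^gz^d\,p_\alpha q_\beta\,u^{l(\beta)}\frac{\tilde H^g_{\alpha,\beta}}{r^g_{\alpha,\beta}!\,|\operatorname{Aut}\alpha|\,|\operatorname{Aut}\beta|},$$ where in the second sum the terms with $r^g_{\alpha,\beta}<0$ are zero, and the term $d=0$ equals $y$. These are formal power series in $z$ whose coefficients are polynomials in the $p_i,q_i,u$ over the formal Laurent series in $y$ with rational coefficients. **Schur functions.** For $\lambda\vdash d$ let $s_\lambda(p_1,p_2,\ldots)$ be the Schur symmetric function written as a polynomial in the power sums $p_1,p_2,\ldots$, that is, $s_\lambda=\det\bigl(h_{\lambda_i-i+j}\bigr)_{1\le i,j\le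 l(\lambda)}$, where $h_n=0$ for $n<0$ and $\sum_{n\ge0}h_nx^n=\exp\bigl(\sum_{k\ge1}p_kx^k/k\bigr)$. Let $$\eta(\lambda)=\sum_i\binom{\lambda_i}{2}-\sum_i\binom{\tilde\lambda_i}{2},$$ where $\tilde\lambda$ is the conjugate partition of $\lambda$. **Theorem.** Let $$Z=1+\sum_{d\ge1}z^d\sum_{\lambda\vdash d}e^{\eta(\lambda)t}\,s_\lambda(p_1t^{-1},p_2t^{-1},\ldots)\,s_\lambda(q_1ut^{-1},q_2ut^{-1},\ldots),$$ a formal power series in $z$ whose coefficients are polynomials in the $p_i,q_i,u$ over the formal Laurent series in $t$. Then $$H\big|_{y=t^2}=t^2\log Z\qquad\text{and}\qquad\tilde H\big|_{y=t^2}=t^2Z.$$ -/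

import Mathlib

namespace DoubleHurwitz

open Finset

/-! ### Partitions -/

/-- The number of parts `l(α)`. -/
def len {d : ℕ} (α : d.Partition) : ℕ := α.parts.card

/-- `|Aut α| = ∏ aᵢ!`, where `aᵢ` is the number of parts of `α` equal to `i`. -/
def autCard {d : ℕ} (α : d.Partition) : ℕ :=
  ∏ i ∈ α.parts.toFinset, (α.parts.count i).factorial

/-- The size of the `j`-th part (`j ≥ 1`) of the conjugate partition: the number of parts of `lam`
that are at least `j`. -/
def conjPart {d : ℕ} (lam : d.Partition) (j : ℕ) : ℕ :=
  (lam.parts.filter (fun i => j ≤ i)).card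

/-- `η(λ) = ∑ᵢ C(λᵢ, 2) - ∑ⱼ C(λ'ⱼ, 2)`, with `λ'` the conjugate partition. -/
def eta {d : ℕ} (lam : d.Partition) : ℤ :=
  (((lam.parts.map (fun i => i.choose 2)).sum : ℕ) : ℤ)
    - ((∑ j ∈ Finset.Icc 1 d, (conjPart lam j).choose 2 : ℕ) : ℤ)

/-! ### Schur functions as polynomials in the power sums -/

/-- The complete symmetric function `hₙ` as a polynomial in the power sums `pₖ = X k`, `k ≥ 1`
(the variable `X 0` does not occur): `hₙ = ∑_{μ ⊢ n} z_μ⁻¹ p_μ`, with `z_μ = |Aut μ| ∏ᵢ μᵢ`;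
equivalently `∑ₙ hₙ xⁿ = exp (∑_{k ≥ 1} pₖ xᵏ / k)`. -/
noncomputable def complete (n : ℕ) : MvPolynomial ℕ ℚ :=
  ∑ μ : n.Partition,
    MvPolynomial.C (((autCard μ * μ.parts.prod : ℕ) : ℚ)⁻¹) * (μ.parts.map MvPolynomial.X).prod

/-- `hₙ` for an integer index, zero when `n < 0`. -/
noncomputable def completeInt (n : ℤ) : MvPolynomial ℕ ℚ :=
  if 0 ≤ n then complete n.toNat else 0

/-- The parts of a partition in weakly decreasing order. -/
def rows {d : ℕ} (lam : d.Partition) : List ℕ := lam.parts.sort (· ≥ ·)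

/-- The Schur symmetric function `s_λ = det (h_{λᵢ - i + j})`, `1 ≤ i, j ≤ l(λ)`, as a polynomial
in the power sums. -/
noncomputable def schur {d : ℕ} (lam : d.Partition) : MvPolynomial ℕ ℚ :=
  Matrix.det (Matrix.of fun i j : Fin (rows lam).length =>
    completeInt (((rows lam).get i : ℤ) - (i : ℤ) + (j : ℤ)))

/-! ### Double Hurwitz numbers -/

/-- The number `r = -2 + 2g + l(α) + l(β)` of simple branch points. -/
def numSimple (g : ℤ) {d : ℕ} (α β : d.Partition) : ℤ := -2 + 2 * g + len α + len β

/-- `(σ, τ₁, …, τᵣ, γ)` is an ordered factorization: `σ` has cycle type `β`, `γ` has cycle type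
`α`, the `τᵢ` are transpositions, and `τᵣ ⋯ τ₁ σ = γ`. -/
def IsFactorization {d r : ℕ} (α β : d.Partition)
    (σ : Equiv.Perm (Fin d)) (τ : Fin r → Equiv.Perm (Fin d)) (γ : Equiv.Perm (Fin d)) : Prop :=
  σ.partition.parts = β.parts ∧ γ.partition.parts = α.parts ∧ (∀ i, (τ i).IsSwap) ∧
    (List.ofFn τ).reverse.prod * σ = γ

/-- The group generated by `σ, τ₁, …, τᵣ` acts transitively on the sheets. -/
def IsTransitive {d r : ℕ} (σ : Equiv.Perm (Fin d)) (τ : Fin r → Equiv.Perm (Fin d)) : Prop :=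
  MulAction.IsPretransitive (Subgroup.closure (insert σ (Set.range τ))) (Fin d)

/-- The number of ordered factorizations with `r` transpositions. -/
noncomputable def factorizationCount (r : ℕ) {d : ℕ} (α β : d.Partition) : ℕ :=
  Nat.card {x : Equiv.Perm (Fin d) × (Fin r → Equiv.Perm (Fin d)) × Equiv.Perm (Fin d) //
    IsFactorization α β x.1 x.2.1 x.2.2}

/-- The number of transitive ordered factorizations with `r` transpositions. -/
noncomputable def transitiveCount (r : ℕ) {d : ℕ} (α β : d.Partition) : ℕ :=
  Nat.card {x : Equiv.Perm (Fin d) × (Fin r → Equiv.Perm (Fin d)) × Equiv.Perm (Fin d) //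
    IsFactorization α β x.1 x.2.1 x.2.2 ∧ IsTransitive x.1 x.2.1}

/-- The (connected) double Hurwitz number of genus `g`. -/
noncomputable def hurwitz (g : ℤ) {d : ℕ} (α β : d.Partition) : ℚ :=
  if 0 ≤ numSimple g α β then
    (autCard α * autCard β : ℚ) / d.factorial * transitiveCount (numSimple g α β).toNat α β
  else 0

/-- The possibly disconnected double Hurwitz number of genus `g`; here `g` can be negative
(`2 - 2g` is the Euler characteristic of the covering surface). -/
noncomputable def hurwitzDisc (g : ℤ) {d : ℕ} (α β : d.Partition) : ℚ :=
  if 0 ≤ numSimple g α β then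
    (autCard α * autCard β : ℚ) / d.factorial * factorizationCount (numSimple g α β).toNat α β
  else 0

/-! ### The generating series

All series live in `K((·))[p₁, p₂, …, q₁, q₂, …, u]⟦z⟧` with `K = ℚ`, the Laurent series variable
being `y` or `t`: for each power of `z` only finitely many monomials in the `pᵢ, qᵢ, u` occur, each
with a Laurent series in `y` (or `t`) as its coefficient. -/

/-- The indeterminates `pᵢ`, `qᵢ` (only `i ≥ 1` is used) and `u`. -/
inductive Var : Type
  | p (i : ℕ) : Var
  | q (i : ℕ) : Var
  | u : Var

/-- Polynomials in the `pᵢ, qᵢ, u` over the Laurent series in one variable. -/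
abbrev Coeffs : Type := MvPolynomial Var (LaurentSeries ℚ)

/-- The monomial `p_α q_β u^{l(β)}`. -/
noncomputable def monomialPQU {d : ℕ} (α β : d.Partition) : Coeffs :=
  (α.parts.map (fun i => MvPolynomial.X (Var.p i))).prod
    * (β.parts.map (fun i => MvPolynomial.X (Var.q i))).prod * MvPolynomial.X Var.u ^ len β

/-- The double Hurwitz series `H`, the Laurent variable being `y`:
`∑_{g ≥ 0, d ≥ 1} ∑_{α, β ⊢ d} y^g z^d p_α q_β u^{l(β)} H^g_{α,β} / (r! |Aut α| |Aut β|)`. -/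
noncomputable def hurwitzSeries : PowerSeries Coeffs :=
  PowerSeries.mk fun d => if d = 0 then 0 else
    ∑ α : d.Partition, ∑ β : d.Partition,
      MvPolynomial.C (HahnSeries.ofPowerSeries ℤ ℚ (PowerSeries.mk fun g : ℕ =>
        hurwitz g α β / ((numSimple g α β).toNat.factorial * autCard α * autCard β)))
      * monomialPQU α β

/-- For fixed `α, β`, the coefficients of `H̃` vanish for all sufficiently negative `g`. -/
theorem bddBelow_support_disc {d : ℕ} (α β : d.Partition) :
    BddBelow (Function.support fun g : ℤ =>
      hurwitzDisc g α β / ((numSimple g α β).toNat.factorial * autCard α * autCard β : ℚ)) := by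
  refine ⟨-(len α + len β : ℤ), fun g hg => ?_⟩
  by_contra hlt
  apply hg
  have h : ¬ (0 ≤ numSimple g α β) := by
    unfold numSimple
    omega
  simp [hurwitzDisc, h]

/-- The series `H̃` of possibly disconnected double Hurwitz numbers, the Laurent variable being `y`:
`∑_{g ∈ ℤ, d ≥ 0} ∑_{α, β ⊢ d} y^g z^d p_α q_β u^{l(β)} H̃^g_{α,β} / (r! |Aut α| |Aut β|)`. -/
noncomputable def hurwitzDiscSeries : PowerSeries Coeffs :=
  PowerSeries.mk fun d =>
    ∑ α : d.Partition, ∑ β : d.Partition,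
      MvPolynomial.C (HahnSeries.ofSuppBddBelow _ (bddBelow_support_disc α β)) * monomialPQU α β

/-- The substitution `y = t²` on Laurent series. -/
noncomputable def laurentSquare : LaurentSeries ℚ →+* LaurentSeries ℚ :=
  HahnSeries.embDomainRingHom (R := ℚ) (AddMonoidHom.mulLeft (2 : ℤ))
    (fun a b h => by simpa using h) (fun a b => by simp)

/-- The substitution `y = t²` on generating series. -/
noncomputable def substSquare : PowerSeries Coeffs →+* PowerSeries Coeffs :=
  PowerSeries.map (MvPolynomial.map laurentSquare)

/-- The power `t ^ k`, `k ∈ ℤ`, as a constant polynomial in the `pᵢ, qᵢ, u`. -/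
noncomputable def tPow (k : ℤ) : Coeffs := MvPolynomial.C (HahnSeries.single k (1 : ℚ))

/-- `e^{ct}` as a Laurent series in `t`. -/
noncomputable def expT (c : ℚ) : LaurentSeries ℚ :=
  HahnSeries.ofPowerSeries ℤ ℚ (PowerSeries.rescale c (PowerSeries.exp ℚ))

/-- `Z = 1 + ∑_{d ≥ 1} z^d ∑_{λ ⊢ d} e^{η(λ)t} s_λ(p₁t⁻¹, p₂t⁻¹, …) s_λ(q₁ut⁻¹, q₂ut⁻¹, …)`. -/
noncomputable def Z : PowerSeries Coeffs :=
  1 + PowerSeries.mk fun d => if d = 0 then 0 else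
    ∑ lam : d.Partition, MvPolynomial.C (expT (eta lam))
      * MvPolynomial.aeval (fun k => MvPolynomial.X (Var.p k) * tPow (-1)) (schur lam)
      * MvPolynomial.aeval
          (fun k => MvPolynomial.X (Var.q k) * MvPolynomial.X Var.u * tPow (-1)) (schur lam)

end DoubleHurwitz

/-!
The theorem has three parts: a formula of Frobenius for the number of all factorizations, the
exponential formula that passes to the transitive ones, and two elementary facts on the number of
cycles of a product with transpositions.

*The Frobenius count.* Instead of representation theory, the character values are defined by
Frobenius' formula: `frob (shifted lam) α` is the coefficient of `x^μ` in `det (x_i ^ j) p_α(x)`,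
with `μ` the strictly increasing exponent `(λ_d, λ_{d-1} + 1, …, λ₁ + d - 1)`. What the count
needs to know about them is proved directly.

* They are the coefficients of the Schur functions in power sums (`aeval_schur`), by the expansion
  of the Jacobi-Trudi determinant.
* They are orthogonal. The rows come from the bialternant formula (`alternant_mul_det`), and the
  columns, `sum_frob_shifted_mul_frob_column`, follow because the table is a square matrix.
* They are eigenfunctions of the sum of all transpositions, with eigenvalue `η(λ)`
  (`sum_frobPerm_swap_mul`). Here `p_σ(x)` is the sum of the monomials of all colourings of the
  points by the indices of the variables that are constant on the cycles of `σ`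
  (`cycleWeight_powerSum`). For a product `swap i j * σ`, the colourings in which `i` and `j` have
  the same colour give second derivatives of `p_σ`. Those in which they have different colours `a`
  and `b` colour two complementary arcs of one cycle of `σ`; moving an end of an arc by one point
  multiplies the monomial by `x_a / x_b`, so that their sum telescopes (`sub_mul_sum_arcs`). Times
  the alternant, it gives the products of first derivatives of `p_σ` and of the alternant, up to
  constants. So multiplication by the alternant turns the sum over all transpositions into
  `∑ (x_a ∂/∂x_a)²`, up to constants, for which monomials are eigenvectors
  (`coeff_alternant_mul_sum_swap`).

Hence the indicator of a class, expanded in characters, gives `factorizationCount_eq`, and the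
summation over the number `r` of transpositions turns `η(λ)^r` into `e^(η(λ) t)`: the coefficient
of `z^d` in `Z` is the exponential generating function of all factorizations in `S_d`, up to a
rescaling of the variables (`coeff_Z`).

*The exponential formula.* A factorization splits uniquely into a transitive factorization on the
orbit of the point `0` and an arbitrary one on the complement, whose transpositions are shuffled
(`sum_orbit_eq`). This is the differential equation `Z' = h' Z` for the transitive series `h`
(`succ_mul_discEgf`), and its solution without constant term is `log Z`
(`eq_logOf_of_derivative`).

*Genus.* The sums over `g` and over `r = 2 g - 2 + l(α) + l(β)` have the same terms: no
factorization exists if `r + l(α) + l(β)` is odd (`numCycles_parity`), and no transitive one with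
`g < 0` (`numCycles_add_le_of_noInvariant`), which is why the connected series may start at
`g = 0`.
-/

namespace DoubleHurwitz

open Finset Equiv

/-! ### Cycle weights of permutations -/

section CycleWeight

variable {V : Type*} [Fintype V] [DecidableEq V] {R : Type*} [CommSemiring R]

/-- The monomial `∏ P_k`, over the lengths `k` of the cycles of `σ` (fixed points included). -/
def cycleWeight (P : ℕ → R) (σ : Perm V) : R := (σ.partition.parts.map P).prod

theorem cycleWeight_eq (P : ℕ → R) (σ : Perm V) :
    cycleWeight P σ = (∏ c ∈ σ.cycleFactorsFinset, P c.support.card) *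
      ∏ _v ∈ σ.supportᶜ, P 1 := by
  rw [cycleWeight, Perm.parts_partition, Multiset.map_add, Multiset.prod_add, Perm.cycleType_def,
    Multiset.map_map, Multiset.map_replicate, Multiset.prod_replicate, prod_const, card_compl]
  rfl

/-- The cycle weight as a product over the cycles, regarded as the classes of the relation
"in the same cycle". -/
theorem cycleWeight_eq_prod_quotient (P : ℕ → R) (σ : Perm V)
    [Fintype (Quotient (Perm.SameCycle.setoid σ))]
    [DecidableEq (Quotient (Perm.SameCycle.setoid σ))] :
    cycleWeight P σ = ∏ q : Quotient (Perm.SameCycle.setoid σ),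
      P (univ.filter fun v => Quotient.mk (Perm.SameCycle.setoid σ) v = q).card := by
  have hclass : ∀ v w : V, Quotient.mk (Perm.SameCycle.setoid σ) v = Quotient.mk _ w ↔
      σ.SameCycle v w := fun v w => Quotient.eq (r := Perm.SameCycle.setoid σ)
  rw [cycleWeight_eq, ← prod_filter_mul_prod_filter_not univ (fun q => q.out ∈ σ.support)]
  congr 1
  · symm
    refine prod_bij (fun q _ => σ.cycleOf q.out) ?_ ?_ ?_ ?_
    · intro q hq
      exact Perm.cycleOf_mem_cycleFactorsFinset_iff.mpr (mem_filter.mp hq).2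
    · intro q hq q' hq' h
      have := (Perm.sameCycle_iff_cycleOf_eq_of_mem_support (mem_filter.mp hq).2
        (mem_filter.mp hq').2).mpr h
      rw [← q.out_eq, ← q'.out_eq]
      exact (hclass _ _).mpr this
    · intro c hc
      have hcyc := (Perm.mem_cycleFactorsFinset_iff.mp hc).1
      obtain ⟨v, hv⟩ := hcyc.nonempty_support
      have hvs : v ∈ σ.support := Perm.mem_cycleFactorsFinset_support_le hc hv
      have hsc : σ.SameCycle v (Quotient.mk (Perm.SameCycle.setoid σ) v).out :=
        (hclass _ _).mp (Quotient.out_eq _).symm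
      have hout : (Quotient.mk (Perm.SameCycle.setoid σ) v).out ∈ σ.support := by
        obtain ⟨i, hi⟩ := hsc
        rw [← hi]
        simpa using hvs
      refine ⟨Quotient.mk _ v, mem_filter.mpr ⟨mem_univ _, hout⟩, ?_⟩
      rw [(Perm.sameCycle_iff_cycleOf_eq_of_mem_support hvs hout).mp hsc |>.symm]
      exact (Perm.cycle_is_cycleOf hv hc).symm
    · intro q hq
      have hq' := (mem_filter.mp hq).2
      congr 2
      ext v
      rw [mem_filter, Perm.mem_support_cycleOf_iff' (Perm.mem_support.mp hq')]
      conv_lhs => rw [← q.out_eq]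
      rw [hclass, Perm.sameCycle_comm]
      simp
  · symm
    have hfix : ∀ v w : V, v ∉ σ.support → σ.SameCycle v w → w = v := by
      rintro v w hv ⟨i, rfl⟩
      exact Perm.zpow_apply_eq_self_of_apply_eq_self (Perm.notMem_support.mp hv) i
    refine prod_bij (fun q _ => q.out) ?_ ?_ ?_ ?_
    · intro q hq
      exact mem_compl.mpr (mem_filter.mp hq).2
    · intro q _ q' _ h
      rw [← q.out_eq, ← q'.out_eq, h]
    · intro v hv
      rw [mem_compl] at hv
      have hout := hfix v (Quotient.mk (Perm.SameCycle.setoid σ) v).out hv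
        ((hclass _ _).mp (Quotient.out_eq _).symm)
      exact ⟨Quotient.mk _ v, mem_filter.mpr ⟨mem_univ _, by rwa [hout]⟩, hout⟩
    · intro q hq
      have hq' := (mem_filter.mp hq).2
      have : (univ.filter fun v => Quotient.mk (Perm.SameCycle.setoid σ) v = q) = {q.out} := by
        ext v
        rw [mem_filter, mem_singleton]
        conv_lhs => rw [← q.out_eq]
        rw [hclass]
        refine ⟨fun h => hfix _ _ hq' h.2.symm, fun h => ⟨mem_univ _, h ▸ Perm.SameCycle.refl _ _⟩⟩
      rw [this, card_singleton]

variable {ι : Type*} [Fintype ι] [DecidableEq ι]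

/-- The power sum `p_σ(x)` attached to the cycle type of `σ` enumerates the functions that are
constant on the cycles of `σ`. -/
theorem cycleWeight_powerSum (x : ι → R) (σ : Perm V) :
    cycleWeight (fun k => ∑ a, x a ^ k) σ =
      ∑ f : V → ι with f ∘ σ = f, ∏ v, x (f v) := by
  classical
  rw [cycleWeight_eq_prod_quotient, Finset.prod_univ_sum]
  refine sum_bij' (fun F _ v => F (Quotient.mk _ v)) (fun f _ q => f q.out) ?_ ?_ ?_ ?_ ?_
  · intro F _
    refine mem_filter.mpr ⟨mem_univ _, funext fun v => congrArg F ?_⟩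
    exact Quotient.eq.mpr (Perm.SameCycle.refl σ v).apply_left
  · intro f _
    simp
  · intro F _
    funext q
    exact congrArg F q.out_eq
  · intro f hf
    have hf' := (mem_filter.mp hf).2
    funext v
    obtain ⟨i, hi⟩ : σ.SameCycle (Quotient.mk (Perm.SameCycle.setoid σ) v).out v :=
      Quotient.eq.mp (Quotient.out_eq (Quotient.mk (Perm.SameCycle.setoid σ) v))
    have hpow : ∀ i : ℕ, ∀ w, f ((σ ^ i) w) = f w := by
      intro i
      induction i with
      | zero => simp
      | succ i ih =>
        intro w
        rw [pow_succ, Perm.mul_apply, ih]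
        exact congrFun hf' w
    have hzpow : ∀ w, f ((σ ^ i) w) = f w := by
      intro w
      obtain ⟨m, rfl | rfl⟩ := i.eq_nat_or_neg
      · rw [zpow_natCast, hpow]
      · rw [← hpow m ((σ ^ (-(m : ℤ))) w), ← Perm.mul_apply, ← zpow_natCast, ← zpow_add]
        simp
    exact (hzpow _).symm.trans (congrArg f hi)
  · intro F _
    rw [← prod_fiberwise univ (fun v => Quotient.mk (Perm.SameCycle.setoid σ) v)]
    refine prod_congr rfl fun q _ => ?_
    rw [prod_congr rfl (g := fun _ => x (F q)), prod_const]
    intro v hv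
    exact congrArg (fun q => x (F q)) (mem_filter.mp hv).2

end CycleWeight

/-! ### Transporting the ends of coloured arcs -/

/-- Recolouring one point exchanges one factor of the monomial of a colouring. -/
theorem mul_prod_update {V : Type*} [Fintype V] [DecidableEq V] {R : Type*} [CommRing R]
    {ι : Type*} (x : ι → R) (f : V → ι) (j : V) (c : ι) :
    x (f j) * ∏ v, x (Function.update f j c v) = x c * ∏ v, x (f v) := by
  rw [← mul_prod_erase univ (fun v => x (f v)) (mem_univ j),
    ← mul_prod_erase univ (fun v => x (Function.update f j c v)) (mem_univ j),
    Function.update_self]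
  rw [prod_congr rfl (g := fun v => x (f v))]
  · ring
  · intro v hv
    rw [Function.update_of_ne (ne_of_mem_erase hv)]

section Transport

variable {V : Type*} [Fintype V] [DecidableEq V] {R : Type*} [CommRing R]
  {ι : Type*} [Fintype ι] [DecidableEq ι]

/-- The triples `(i, j, f)` with `f i = a`, `f j = b` and `f` constant on the cycles of
`swap i j * σ`. For `a ≠ b` the points `i` and `j` lie on one cycle of `σ`, which `swap i j` cuts
into two arcs: `f` is `a` on the arc that starts at `i`, and `b` on the arc that starts at `j`. -/
def arcs (σ : Perm V) (a b : ι) : Finset (V × V × (V → ι)) :=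
  univ.filter fun w => w.2.2 w.1 = a ∧ w.2.2 w.2.1 = b ∧
    ∀ k, w.2.2 (swap w.1 w.2.1 (σ k)) = w.2.2 k

/-- The pairs `(i, f)` with `f i = a` and `f` constant on the cycles of `σ`. -/
def marked (σ : Perm V) (a : ι) : Finset (V × (V → ι)) :=
  univ.filter fun w => w.2 w.1 = a ∧ ∀ k, w.2 (σ k) = w.2 k

/-- The arc coloured `b` starts at `j`, and recolouring its first point `j` with `a` moves its start
to `σ j`. This exchanges a factor `x b` for a factor `x a`. It is possible as long as the arc has at
least two points, and its inverse is possible as long as the arc coloured `a` has at least two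
points. -/
theorem sum_arcs_shift (x : ι → R) (σ : Perm V) {a b : ι} (hab : a ≠ b) :
    ∑ w ∈ arcs σ a b with σ w.2.1 ≠ w.1, x a * ∏ v, x (w.2.2 v) =
      ∑ w ∈ arcs σ a b with w.2.1 ≠ σ w.1, x b * ∏ v, x (w.2.2 v) := by
  refine sum_bij' (fun w _ => (w.1, σ w.2.1, Function.update w.2.2 w.2.1 a))
    (fun w _ => (w.1, σ.symm w.2.1, Function.update w.2.2 (σ.symm w.2.1) b)) ?_ ?_ ?_ ?_ ?_
  · rintro ⟨i, j, f⟩ h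
    simp only [arcs, mem_filter, mem_univ, true_and, Function.update_apply] at h ⊢
    obtain ⟨⟨hi, hj, hf⟩, hij⟩ := h
    have hinj : ∀ k l, σ k = σ l ↔ k = l := fun k l => σ.injective.eq_iff
    have h1 := hf i
    have h2 := hf j
    simp only [swap_apply_def, hinj] at h1 h2 hf ⊢
    refine ⟨⟨?_, ?_, fun k => ?_⟩, ?_⟩
    · clear hf hinj; grind
    · clear hf hinj; grind
    · have h3 := hf k
      have h4 := hinj k j
      have h5 := hinj k i
      clear hf hinj; grind
    · clear hf hinj; grind
  · rintro ⟨i, j, f⟩ h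
    obtain ⟨j, rfl⟩ := σ.surjective j
    simp only [arcs, mem_filter, mem_univ, true_and, Function.update_apply,
      symm_apply_apply] at h ⊢
    obtain ⟨⟨hi, hj, hf⟩, hij⟩ := h
    have hinj : ∀ k l, σ k = σ l ↔ k = l := fun k l => σ.injective.eq_iff
    have h1 := hf i
    have h2 := hf j
    simp only [swap_apply_def, hinj] at h1 h2 hf ⊢
    refine ⟨⟨?_, ?_, fun k => ?_⟩, ?_⟩
    · clear hf hinj; grind
    · clear hf hinj; grind
    · have h3 := hf k
      have h4 := hinj k j
      have h5 := hinj k i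
      clear hf hinj; grind
    · clear hf hinj; grind
  · rintro ⟨i, j, f⟩ h
    simp only [arcs, mem_filter, mem_univ, true_and] at h ⊢
    simp [← h.1.2.1]
  · rintro ⟨i, j, f⟩ h
    obtain ⟨j, rfl⟩ := σ.surjective j
    simp only [arcs, mem_filter, mem_univ, true_and] at h ⊢
    obtain ⟨⟨hi, hj, hf⟩, hij⟩ := h
    have h2 := hf j
    rw [swap_apply_right, hi] at h2
    simp [h2]
  · rintro ⟨i, j, f⟩ h
    simp only [arcs, mem_filter, mem_univ, true_and] at h ⊢
    rw [← h.1.2.1, mul_prod_update]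

/-- When the arc coloured `b` is the single point `j = σ⁻¹ i`, recolouring it makes `f` constant on
the cycles of `σ`, with only the point `i` left as a mark. -/
theorem sum_arcs_end (x : ι → R) (σ : Perm V) {a b : ι} (hab : a ≠ b) :
    ∑ w ∈ arcs σ a b with σ w.2.1 = w.1, x a * ∏ v, x (w.2.2 v) =
      ∑ w ∈ marked σ a with σ w.1 ≠ w.1, x b * ∏ v, x (w.2 v) := by
  refine sum_bij' (fun w _ => (w.1, Function.update w.2.2 w.2.1 a))
    (fun w _ => (w.1, σ.symm w.1, Function.update w.2 (σ.symm w.1) b)) ?_ ?_ ?_ ?_ ?_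
  · rintro ⟨i, j, f⟩ h
    simp only [arcs, marked, mem_filter, mem_univ, true_and, Function.update_apply] at h ⊢
    obtain ⟨⟨hi, hj, hf⟩, hij⟩ := h
    have hinj : ∀ k l, σ k = σ l ↔ k = l := fun k l => σ.injective.eq_iff
    have h1 := hf i
    have h2 := hf j
    simp only [swap_apply_def] at h1 h2 hf ⊢
    refine ⟨⟨?_, fun k => ?_⟩, ?_⟩
    · clear hf hinj; grind
    · have h3 := hf k
      have h4 := hinj k j
      have h5 := hinj k i
      clear hf hinj; grind
    · clear hf hinj; grind
  · rintro ⟨i, f⟩ h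
    obtain ⟨j, rfl⟩ := σ.surjective i
    simp only [arcs, marked, mem_filter, mem_univ, true_and, Function.update_apply,
      symm_apply_apply] at h ⊢
    obtain ⟨⟨hi, hf⟩, hij⟩ := h
    have hinj : ∀ k l, σ k = σ l ↔ k = l := fun k l => σ.injective.eq_iff
    have h2 := hf j
    simp only [swap_apply_def, hinj] at h2 hf ⊢
    refine ⟨⟨?_, ?_, fun k => ?_⟩, ?_⟩
    · clear hf hinj; grind
    · clear hf hinj; grind
    · have h3 := hf k
      have h4 := hinj k j
      clear hf hinj; grind
    · clear hf hinj; grind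
  · rintro ⟨i, j, f⟩ h
    simp only [arcs, mem_filter, mem_univ, true_and] at h ⊢
    simp [← h.1.2.1, ← h.2]
  · rintro ⟨i, f⟩ h
    obtain ⟨j, rfl⟩ := σ.surjective i
    simp only [marked, mem_filter, mem_univ, true_and] at h ⊢
    have h2 := h.1.2 j
    rw [h.1.1] at h2
    simp [h2]
  · rintro ⟨i, j, f⟩ h
    simp only [arcs, mem_filter, mem_univ, true_and] at h ⊢
    rw [← h.1.2.1, mul_prod_update]

theorem sum_arcs_swap (c : R) (x : ι → R) (σ : Perm V) (a b : ι) :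
    ∑ w ∈ arcs σ a b with w.2.1 = σ w.1, c * ∏ v, x (w.2.2 v) =
      ∑ w ∈ arcs σ b a with σ w.2.1 = w.1, c * ∏ v, x (w.2.2 v) := by
  refine sum_bij' (fun w _ => (w.2.1, w.1, w.2.2)) (fun w _ => (w.2.1, w.1, w.2.2)) ?_ ?_ ?_ ?_ ?_
  · rintro ⟨i, j, f⟩ h
    simp only [arcs, mem_filter, mem_univ, true_and] at h ⊢
    rw [swap_comm]
    tauto
  · rintro ⟨i, j, f⟩ h
    simp only [arcs, mem_filter, mem_univ, true_and] at h ⊢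
    rw [swap_comm]
    exact ⟨⟨h.1.2.1, h.1.1, h.1.2.2⟩, h.2.symm⟩
  all_goals simp

/-- A marked fixed point can be recoloured freely. -/
theorem sum_marked_fixed (x : ι → R) (σ : Perm V) (a b : ι) :
    ∑ w ∈ marked σ a with σ w.1 = w.1, x b * ∏ v, x (w.2 v) =
      ∑ w ∈ marked σ b with σ w.1 = w.1, x a * ∏ v, x (w.2 v) := by
  have key : ∀ c d : ι, ∀ w ∈ (marked σ c).filter (fun w => σ w.1 = w.1),
      ((w.1, Function.update w.2 w.1 d) : V × (V → ι)) ∈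
        (marked σ d).filter (fun w => σ w.1 = w.1) := by
    rintro c d ⟨i, f⟩ h
    simp only [marked, mem_filter, mem_univ, true_and, Function.update_apply] at h ⊢
    obtain ⟨⟨hi, hf⟩, hij⟩ := h
    have hinj : ∀ k l, σ k = σ l ↔ k = l := fun k l => σ.injective.eq_iff
    refine ⟨⟨?_, fun k => ?_⟩, hij⟩
    · simp
    · have h3 := hf k
      have h5 := hinj k i
      clear hf hinj; grind
  refine sum_bij' (fun w _ => (w.1, Function.update w.2 w.1 b))
    (fun w _ => (w.1, Function.update w.2 w.1 a)) (key a b) (key b a) ?_ ?_ ?_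
  · rintro ⟨i, f⟩ h
    simp only [marked, mem_filter] at h ⊢
    simp [← h.1.2.1]
  · rintro ⟨i, f⟩ h
    simp only [marked, mem_filter] at h ⊢
    simp [← h.1.2.1]
  · rintro ⟨i, f⟩ h
    simp only [marked, mem_filter] at h ⊢
    rw [← h.1.2.1, mul_prod_update]

/-- Moving the end of an arc by one step multiplies its monomial by `x a / x b`, so that the sum
over the arcs telescopes. -/
theorem sub_mul_sum_arcs (x : ι → R) (σ : Perm V) {a b : ι} (hab : a ≠ b) :
    (x a - x b) * ∑ w ∈ arcs σ a b, ∏ v, x (w.2.2 v) =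
      x b * ∑ w ∈ marked σ a, ∏ v, x (w.2 v) - x a * ∑ w ∈ marked σ b, ∏ v, x (w.2 v) := by
  have h1 := sum_filter_add_sum_filter_not (arcs σ a b) (fun w => σ w.2.1 = w.1)
    (fun w => x a * ∏ v, x (w.2.2 v))
  have h2 := sum_filter_add_sum_filter_not (arcs σ a b) (fun w => w.2.1 = σ w.1)
    (fun w => x b * ∏ v, x (w.2.2 v))
  have h3 := sum_filter_add_sum_filter_not (marked σ a) (fun w => σ w.1 = w.1)
    (fun w => x b * ∏ v, x (w.2 v))
  have h4 := sum_filter_add_sum_filter_not (marked σ b) (fun w => σ w.1 = w.1)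
    (fun w => x a * ∏ v, x (w.2 v))
  rw [sub_mul, mul_sum, mul_sum, mul_sum, mul_sum, ← h1, ← h2, ← h3, ← h4,
    sum_arcs_shift x σ hab, sum_arcs_end x σ hab, sum_arcs_swap, sum_arcs_end x σ hab.symm,
    sum_marked_fixed x σ a b]
  ring

end Transport

/-! ### Euler operators and the alternant -/

section Euler

variable {n : ℕ}

/-- The Euler operator `x_a ∂/∂x_a`. -/
noncomputable def euler (a : Fin n) :
    Derivation ℚ (MvPolynomial (Fin n) ℚ) (MvPolynomial (Fin n) ℚ) :=
  (MvPolynomial.X a : MvPolynomial (Fin n) ℚ) • MvPolynomial.pderiv a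

theorem euler_monomial (a : Fin n) (m : Fin n →₀ ℕ) (c : ℚ) :
    euler a (MvPolynomial.monomial m c) = MvPolynomial.monomial m ((m a : ℚ) * c) := by
  rw [euler, Derivation.smul_apply, MvPolynomial.pderiv_monomial, smul_eq_mul, MvPolynomial.X,
    MvPolynomial.monomial_mul]
  by_cases h : m a = 0
  · simp [h]
  · rw [add_tsub_cancel_of_le]
    · congr 1; ring
    · simpa [Finsupp.single_le_iff] using Nat.one_le_iff_ne_zero.mpr h

theorem coeff_euler (a : Fin n) (m : Fin n →₀ ℕ) (q : MvPolynomial (Fin n) ℚ) :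
    (euler a q).coeff m = m a * q.coeff m := by
  induction q using MvPolynomial.induction_on' with
  | monomial k c =>
    rw [euler_monomial, MvPolynomial.coeff_monomial, MvPolynomial.coeff_monomial]
    split_ifs with h
    · rw [h]
    · simp
  | add p q hp hq => simp [map_add, MvPolynomial.coeff_add, hp, hq, mul_add]

theorem euler_X (a i : Fin n) :
    euler a (MvPolynomial.X i) = if a = i then MvPolynomial.X a else 0 := by
  rw [euler, Derivation.smul_apply, MvPolynomial.pderiv_X, smul_eq_mul, Pi.single_apply]
  split_ifs <;> simp_all

theorem derivation_prod {ι R A : Type*} [DecidableEq ι] [CommRing R] [CommRing A] [Algebra R A]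
    (D : Derivation R A A) (s : Finset ι) (f : ι → A) :
    D (∏ i ∈ s, f i) = ∑ i ∈ s, (∏ j ∈ s.erase i, f j) * D (f i) := by
  induction s using Finset.induction_on with
  | empty => simp
  | insert i s hi ih =>
    rw [prod_insert hi, Derivation.leibniz, ih, sum_insert hi, erase_insert hi, smul_eq_mul,
      smul_eq_mul, mul_sum, add_comm]
    congr 1
    refine sum_congr rfl fun j hj => ?_
    have hij : i ≠ j := fun h => hi (h ▸ hj)
    rw [erase_insert_of_ne hij, prod_insert (fun h => hi (mem_of_mem_erase h)), mul_assoc]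

/-- The pairs `i < j` of indices. -/
def ltPairs (n : ℕ) : Finset (Fin n × Fin n) := univ.filter fun w => w.1 < w.2

theorem sum_ltPairs {M : Type*} [AddCommMonoid M] (F : Fin n → Fin n → M) :
    ∑ w ∈ ltPairs n, (F w.1 w.2 + F w.2 w.1) = ∑ a, ∑ b ∈ univ.erase a, F a b := by
  have h1 : ∑ w ∈ ltPairs n, F w.1 w.2 = ∑ a, ∑ b with a < b, F a b := by
    rw [ltPairs, sum_filter, Fintype.sum_prod_type]
    exact sum_congr rfl fun a _ => (sum_filter _ _).symm
  have h2 : ∑ w ∈ ltPairs n, F w.2 w.1 = ∑ a, ∑ b with b < a, F a b := by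
    rw [ltPairs, sum_filter, Fintype.sum_prod_type_right]
    exact sum_congr rfl fun a _ => (sum_filter _ _).symm
  rw [sum_add_distrib, h1, h2, ← sum_add_distrib]
  refine sum_congr rfl fun a _ => ?_
  rw [← sum_union]
  · refine sum_congr ?_ fun _ _ => rfl
    ext b
    simp only [mem_union, mem_filter, mem_univ, true_and, mem_erase, and_true]
    rw [lt_or_lt_iff_ne, ne_comm]
  · rw [disjoint_filter]
    exact fun b _ h => h.not_gt

/-- The alternant `det (x_i ^ j)`. -/
noncomputable def alternant (n : ℕ) : MvPolynomial (Fin n) ℚ :=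
  (Matrix.vandermonde fun i : Fin n => (MvPolynomial.X i : MvPolynomial (Fin n) ℚ)).det

theorem alternant_eq_prod (n : ℕ) : alternant n =
    ∏ w ∈ ltPairs n, (MvPolynomial.X w.2 - MvPolynomial.X w.1 : MvPolynomial (Fin n) ℚ) := by
  rw [alternant, Matrix.det_vandermonde, ltPairs, prod_filter, Fintype.prod_prod_type]
  refine prod_congr rfl fun i _ => ?_
  rw [← prod_filter]
  refine prod_congr ?_ fun _ _ => rfl
  ext j
  simp

/-- The exponent `(w⁻¹ 0, w⁻¹ 1, …)`. -/
noncomputable def permExponent (w : Perm (Fin n)) : Fin n →₀ ℕ :=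
  Finsupp.equivFunOnFinite.symm fun i => (w.symm i : ℕ)

theorem alternant_eq_sum (n : ℕ) : alternant n =
    ∑ w : Perm (Fin n), MvPolynomial.monomial (permExponent w) ((Perm.sign w : ℤ) : ℚ) := by
  rw [alternant, Matrix.det_apply]
  refine sum_congr rfl fun w _ => ?_
  have : ∏ i, Matrix.vandermonde (fun i : Fin n => (MvPolynomial.X i : MvPolynomial (Fin n) ℚ))
      (w i) i = MvPolynomial.monomial (permExponent w) 1 := by
    rw [MvPolynomial.monomial_eq, Finsupp.prod_fintype _ _ (by simp),
      ← Equiv.prod_comp w (fun i => (MvPolynomial.X i : MvPolynomial (Fin n) ℚ) ^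
        (permExponent w) i)]
    simp [Matrix.vandermonde, permExponent]
  rw [this, Units.smul_def, ← Int.cast_smul_eq_zsmul ℚ, MvPolynomial.smul_monomial, smul_eq_mul,
    mul_one]

/-- The alternant is an eigenfunction of `∑ (x_a ∂/∂x_a)²`, because its exponents are the
permutations of `(0, 1, …, n - 1)`. -/
theorem sum_euler_sq_alternant (n : ℕ) :
    ∑ a, euler a (euler a (alternant n)) =
      MvPolynomial.C (∑ i : Fin n, (i : ℚ) ^ 2) * alternant n := by
  rw [alternant_eq_sum, mul_sum]
  simp only [map_sum, euler_monomial]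
  rw [sum_comm]
  refine sum_congr rfl fun w _ => ?_
  rw [← map_sum MvPolynomial.C, MvPolynomial.C_mul_monomial,
    ← map_sum (MvPolynomial.monomial (permExponent w)), sum_mul, ← Equiv.sum_comp w]
  refine congrArg _ (sum_congr rfl fun i _ => ?_)
  simp only [permExponent, Finsupp.equivFunOnFinite_symm_apply_apply, symm_apply_apply]
  ring

/-- Multiplying by the alternant turns the sum over all arcs into a first order operator. -/
theorem alternant_mul_sum_eq (p : MvPolynomial (Fin n) ℚ)
    (S : Fin n → Fin n → MvPolynomial (Fin n) ℚ)
    (hS : ∀ a b, a ≠ b → (MvPolynomial.X a - MvPolynomial.X b) * S a b =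
      MvPolynomial.X b * euler a p - MvPolynomial.X a * euler b p) :
    alternant n * ∑ a, ∑ b ∈ univ.erase a, S a b =
      2 * ∑ a, euler a (alternant n) * euler a p
        - 2 * ((n : MvPolynomial (Fin n) ℚ) - 1) * (alternant n * ∑ a, euler a p) := by
  have hE : ∑ w ∈ ltPairs n, (euler w.1 p + euler w.2 p) =
      ((n : MvPolynomial (Fin n) ℚ) - 1) * ∑ a, euler a p := by
    rw [sum_ltPairs (fun a _ => euler a p), mul_sum]
    refine sum_congr rfl fun a _ => ?_
    rw [sum_const, card_erase_of_mem (mem_univ a), card_univ, Fintype.card_fin, nsmul_eq_mul,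
      Nat.cast_sub (Nat.one_le_of_lt a.pos), Nat.cast_one]
  have hD : ∑ a, euler a (alternant n) * euler a p =
      ∑ w ∈ ltPairs n, (∏ v ∈ (ltPairs n).erase w, (MvPolynomial.X v.2 - MvPolynomial.X v.1)) *
        (MvPolynomial.X w.2 * euler w.2 p - MvPolynomial.X w.1 * euler w.1 p) := by
    rw [alternant_eq_prod]
    simp only [derivation_prod, map_sub, euler_X, sum_mul]
    rw [sum_comm]
    refine sum_congr rfl fun w _ => ?_
    simp [mul_assoc, ← mul_sum, sub_mul, sum_sub_distrib]
  rw [← sum_ltPairs, show 2 * ((n : MvPolynomial (Fin n) ℚ) - 1) * (alternant n * ∑ a, euler a p) =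
    2 * (alternant n * (((n : MvPolynomial (Fin n) ℚ) - 1) * ∑ a, euler a p)) by ring, ← hE, hD]
  simp only [mul_sum, ← sum_sub_distrib]
  refine sum_congr rfl fun w hw => ?_
  have hlt : w.1 < w.2 := (mem_filter.mp hw).2
  have h1 := hS _ _ hlt.ne
  have h2 := hS _ _ hlt.ne'
  rw [alternant_eq_prod, ← mul_prod_erase _ _ hw]
  linear_combination (∏ v ∈ (ltPairs n).erase w, (MvPolynomial.X v.2 - MvPolynomial.X v.1)) *
    (h2 - h1)

end Euler

/-! ### Transpositions acting on power sums -/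

section Transpositions

variable {V : Type*} [Fintype V] [DecidableEq V] {n : ℕ}

/-- The power sum symmetric polynomial in `n` variables attached to the cycle type of `σ`. -/
noncomputable def powerSum (n : ℕ) (σ : Perm V) : MvPolynomial (Fin n) ℚ :=
  cycleWeight (fun k => ∑ a, MvPolynomial.X a ^ k) σ

theorem powerSum_eq (σ : Perm V) : powerSum n σ =
    ∑ f : V → Fin n with ∀ k, f (σ k) = f k, ∏ v, MvPolynomial.X (f v) := by
  rw [powerSum, cycleWeight_powerSum]
  exact sum_congr (filter_congr fun f _ => funext_iff) fun _ _ => rfl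

theorem euler_prod_X (a : Fin n) (f : V → Fin n) :
    euler a (∏ v, MvPolynomial.X (f v)) =
      ∑ i, if f i = a then ∏ v, MvPolynomial.X (f v) else 0 := by
  rw [derivation_prod]
  refine sum_congr rfl fun i _ => ?_
  rw [euler_X]
  split_ifs with h h' h'
  · rw [h, mul_comm, mul_prod_erase univ (fun v => MvPolynomial.X (f v)) (mem_univ i)]
  · exact absurd h.symm h'
  · exact absurd h'.symm h
  · exact mul_zero _

theorem euler_powerSum (a : Fin n) (σ : Perm V) :
    euler a (powerSum n σ) = ∑ w ∈ marked σ a, ∏ v, MvPolynomial.X (w.2 v) := by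
  rw [powerSum_eq, map_sum, marked, sum_filter, sum_filter, Fintype.sum_prod_type_right]
  refine sum_congr rfl fun f _ => ?_
  rw [euler_prod_X]
  by_cases h : ∀ k, f (σ k) = f k
  · simp [h]
  · simp [h]

theorem sum_euler_powerSum (σ : Perm V) :
    ∑ a, euler a (powerSum n σ) = (Fintype.card V : MvPolynomial (Fin n) ℚ) * powerSum n σ := by
  simp only [powerSum_eq, map_sum, euler_prod_X]
  rw [sum_comm, mul_sum]
  refine sum_congr rfl fun f _ => ?_
  rw [sum_comm]
  simp

theorem euler_sq_sub_prod_X (a : Fin n) (f : V → Fin n) :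
    euler a (euler a (∏ v, MvPolynomial.X (f v))) - euler a (∏ v, MvPolynomial.X (f v)) =
      ∑ i, ∑ j ∈ univ.erase i, if f i = a ∧ f j = a then ∏ v, MvPolynomial.X (f v) else 0 := by
  have h : ∀ i j : V, (if f i = a ∧ f j = a then
      (∏ v, MvPolynomial.X (f v) : MvPolynomial (Fin n) ℚ) else 0) =
      if f i = a then (if f j = a then ∏ v, MvPolynomial.X (f v) else 0) else 0 := by
    intro i j
    split_ifs <;> simp_all
  rw [euler_prod_X, map_sum, ← sum_sub_distrib]
  refine sum_congr rfl fun i _ => ?_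
  simp only [h]
  split_ifs with hi
  · rw [euler_prod_X, ← add_sum_erase _ _ (mem_univ i), if_pos hi, add_sub_cancel_left]
  · simp

/-- The sum of the power sums over all products `swap i j * σ`, regarded as a sum over
colourings that are constant on the cycles, and split according to whether `i` and `j` have the same
colour. -/
theorem sum_powerSum_swap_mul (σ : Perm V) :
    ∑ i, ∑ j ∈ univ.erase i, powerSum n (swap i j * σ) =
      ∑ a, (euler a (euler a (powerSum n σ)) - euler a (powerSum n σ)) +
        ∑ a, ∑ b ∈ univ.erase a, ∑ w ∈ arcs σ a b,
          (∏ v, MvPolynomial.X (w.2.2 v) : MvPolynomial (Fin n) ℚ) := by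
  have h1 : ∀ i j : V, powerSum n (swap i j * σ) =
      ∑ a, ∑ b, ∑ f : V → Fin n, if f i = a ∧ f j = b ∧ ∀ k, f (swap i j (σ k)) = f k then
        (∏ v, MvPolynomial.X (f v) : MvPolynomial (Fin n) ℚ) else 0 := by
    intro i j
    rw [powerSum_eq, sum_filter]
    symm
    rw [sum_congr rfl fun a _ => sum_comm, sum_comm]
    refine sum_congr rfl fun f _ => ?_
    rw [sum_eq_single (f i) (fun a _ ha => sum_eq_zero fun b _ => if_neg fun h => ha h.1.symm)
      (by simp), sum_eq_single (f j) (fun b _ hb => if_neg fun h => hb h.2.1.symm) (by simp)]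
    simp only [true_and]
    congr
  have h2 : ∀ a b : Fin n, a ≠ b → ∑ i, ∑ j ∈ univ.erase i, ∑ f : V → Fin n,
      (if f i = a ∧ f j = b ∧ ∀ k, f (swap i j (σ k)) = f k then
        (∏ v, MvPolynomial.X (f v) : MvPolynomial (Fin n) ℚ) else 0) =
      ∑ w ∈ arcs σ a b, (∏ v, MvPolynomial.X (w.2.2 v) : MvPolynomial (Fin n) ℚ) := by
    intro a b hab
    rw [arcs, sum_filter, Fintype.sum_prod_type]
    refine sum_congr rfl fun i _ => ?_
    rw [Fintype.sum_prod_type]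
    refine sum_subset (subset_univ _) fun j _ hj => ?_
    have hij : i = j := by simpa [eq_comm] using hj
    refine sum_eq_zero fun f _ => if_neg fun h => hab ?_
    rw [← h.1, ← h.2.1, hij]
  have h3 : ∀ a : Fin n, ∑ i, ∑ j ∈ univ.erase i, ∑ f : V → Fin n,
      (if f i = a ∧ f j = a ∧ ∀ k, f (swap i j (σ k)) = f k then
        (∏ v, MvPolynomial.X (f v) : MvPolynomial (Fin n) ℚ) else 0) =
      euler a (euler a (powerSum n σ)) - euler a (powerSum n σ) := by
    intro a
    simp only [powerSum_eq, map_sum]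
    rw [← sum_sub_distrib, sum_filter]
    simp only [euler_sq_sub_prod_X]
    rw [sum_congr rfl fun i _ => sum_comm, sum_comm]
    refine sum_congr rfl fun f _ => ?_
    have hsw : ∀ i j : V, f i = a → f j = a →
        ((∀ k, f (swap i j (σ k)) = f k) ↔ ∀ k, f (σ k) = f k) := by
      intro i j hi hj
      have : ∀ k, f (swap i j k) = f k := by
        intro k
        rw [swap_apply_def]
        split_ifs with h h
        · rw [h, hi, hj]
        · rw [h, hi, hj]
        · rfl
      simp only [this]
    split_ifs with hf
    · refine sum_congr rfl fun i _ => sum_congr rfl fun j _ => if_congr ?_ rfl rfl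
      exact ⟨fun h => ⟨h.1, h.2.1⟩, fun h => ⟨h.1, h.2, (hsw i j h.1 h.2).mpr hf⟩⟩
    · exact sum_eq_zero fun i _ => sum_eq_zero fun j _ =>
        if_neg fun h => hf ((hsw i j h.1 h.2.1).mp h.2.2)
  simp only [h1]
  rw [← sum_add_distrib]
  rw [sum_congr rfl fun i _ => sum_comm, sum_comm]
  refine sum_congr rfl fun a _ => ?_
  rw [← h3 a, ← sum_congr rfl fun b hb => h2 a b (ne_of_mem_erase hb).symm]
  rw [add_sum_erase univ (fun b => ∑ i, ∑ j ∈ univ.erase i, ∑ f : V → Fin n,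
      (if f i = a ∧ f j = b ∧ ∀ k, f (swap i j (σ k)) = f k then
        (∏ v, MvPolynomial.X (f v) : MvPolynomial (Fin n) ℚ) else 0)) (mem_univ a)]
  rw [sum_congr rfl fun i _ => sum_comm, sum_comm]

/-- The coefficients of `alternant * powerSum` are eigenfunctions of the sum of all
transpositions. -/
theorem coeff_alternant_mul_sum_swap (σ : Perm V) (m : Fin n →₀ ℕ) :
    (alternant n * ∑ i, ∑ j ∈ univ.erase i, powerSum n (swap i j * σ)).coeff m =
      (∑ a, (m a : ℚ) ^ 2 - ∑ a : Fin n, (a : ℚ) ^ 2 - (2 * n - 1) * Fintype.card V) *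
        (alternant n * powerSum n σ).coeff m := by
  have hL : ∑ a, euler a (euler a (alternant n * powerSum n σ)) =
      (∑ a, euler a (euler a (alternant n))) * powerSum n σ +
        2 * ∑ a, euler a (alternant n) * euler a (powerSum n σ) +
        alternant n * ∑ a, euler a (euler a (powerSum n σ)) := by
    rw [sum_mul, mul_sum, mul_sum, ← sum_add_distrib, ← sum_add_distrib]
    refine sum_congr rfl fun a _ => ?_
    simp only [Derivation.leibniz, map_add, smul_eq_mul]
    ring
  have hcoeff : (∑ a, euler a (euler a (alternant n * powerSum n σ))).coeff m =
      (∑ a, (m a : ℚ) ^ 2) * (alternant n * powerSum n σ).coeff m := by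
    rw [MvPolynomial.coeff_sum, sum_mul]
    refine sum_congr rfl fun a _ => ?_
    rw [coeff_euler, coeff_euler]
    ring
  have hS := alternant_mul_sum_eq (powerSum n σ)
    (fun a b => ∑ w ∈ arcs σ a b, ∏ v, MvPolynomial.X (w.2.2 v)) (fun a b hab => by
      rw [sub_mul_sum_arcs _ σ hab, euler_powerSum, euler_powerSum])
  have hmain : alternant n * ∑ i, ∑ j ∈ univ.erase i, powerSum n (swap i j * σ) =
      ∑ a, euler a (euler a (alternant n * powerSum n σ)) -
        MvPolynomial.C (∑ a : Fin n, (a : ℚ) ^ 2 + (2 * n - 1) * Fintype.card V) *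
          (alternant n * powerSum n σ) := by
    rw [sum_powerSum_swap_mul, mul_add, hS, hL, sum_euler_sq_alternant, sum_sub_distrib,
      sum_euler_powerSum]
    simp only [map_add, map_mul, map_sub, map_natCast, map_one, map_ofNat]
    ring
  rw [hmain, MvPolynomial.coeff_sub, hcoeff, MvPolynomial.coeff_C_mul]
  ring

end Transpositions

/-! ### Complete symmetric functions at given power sums -/

/-- The differential equation `T F' = (∑_{k ≥ 1} Pₖ Tᵏ) F` as a recursion for the coefficients. -/
theorem X_mul_derivative_eq_iff {R : Type*} [CommRing R] (P : ℕ → R) (F : PowerSeries R) :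
    PowerSeries.X * PowerSeries.derivative R F =
        (PowerSeries.mk fun k => if k = 0 then 0 else P k) * F ↔
      ∀ n : ℕ, (n : R) * PowerSeries.coeff n F =
        ∑ k ∈ Icc 1 n, P k * PowerSeries.coeff (n - k) F := by
  rw [PowerSeries.ext_iff]
  refine forall_congr' fun n => ?_
  have h1 : PowerSeries.coeff n (PowerSeries.X * PowerSeries.derivative R F) =
      n * PowerSeries.coeff n F := by
    cases n with
    | zero => simp
    | succ n =>
      rw [PowerSeries.coeff_succ_X_mul, PowerSeries.coeff_derivative]
      push_cast
      ring
  have h2 : PowerSeries.coeff n ((PowerSeries.mk fun k => if k = 0 then 0 else P k) * F) =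
      ∑ k ∈ Icc 1 n, P k * PowerSeries.coeff (n - k) F := by
    rw [PowerSeries.coeff_mul, Nat.sum_antidiagonal_eq_sum_range_succ
      (fun i j => PowerSeries.coeff i (PowerSeries.mk fun k => if k = 0 then 0 else P k) *
        PowerSeries.coeff j F)]
    symm
    refine sum_subset_zero_on_sdiff ?_ ?_ ?_
    · intro k hk
      have := mem_Icc.mp hk
      exact mem_range.mpr (by omega)
    · intro k hk
      have h0 : k = 0 := by
        simp only [mem_sdiff, mem_range, mem_Icc] at hk
        omega
      simp [h0]
    · intro k hk
      have := mem_Icc.mp hk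
      rw [PowerSeries.coeff_mk, if_neg (by omega)]
  rw [h1, h2]

section Complete

/-- The order `z_α = |Aut α| ∏ αᵢ` of the centralizer of a permutation of cycle type `α`. -/
def zee {d : ℕ} (α : d.Partition) : ℕ := autCard α * α.parts.prod

theorem autCard_cons {d e : ℕ} (α : d.Partition) (β : e.Partition) (k : ℕ)
    (h : α.parts = k ::ₘ β.parts) : autCard α = α.parts.count k * autCard β := by
  have hk : k ∈ α.parts := h ▸ Multiset.mem_cons_self k _
  have hsub : β.parts.toFinset ⊆ α.parts.toFinset := by
    rw [h, Multiset.toFinset_cons]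
    exact subset_insert _ _
  have h1 : autCard β = ∏ i ∈ α.parts.toFinset, (β.parts.count i).factorial :=
    prod_subset hsub fun i _ hi => by
      rw [Multiset.count_eq_zero_of_notMem (fun h => hi (Multiset.mem_toFinset.mpr h)),
        Nat.factorial_zero]
  rw [h1, autCard, ← mul_prod_erase _ _ (Multiset.mem_toFinset.mpr hk),
    ← mul_prod_erase _ (fun i => (β.parts.count i).factorial) (Multiset.mem_toFinset.mpr hk),
    ← mul_assoc]
  congr 1
  · rw [h, Multiset.count_cons_self, Nat.factorial_succ]
  · refine prod_congr rfl fun i hi => ?_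
    rw [h, Multiset.count_cons_of_ne (ne_of_mem_erase hi)]

/-- The step from `β` to `α = β ∪ {k}`, where the multiplicity of `k` is taken in `α`. -/
theorem zee_cons {d e : ℕ} (α : d.Partition) (β : e.Partition) (k : ℕ)
    (h : α.parts = k ::ₘ β.parts) : zee α = k * α.parts.count k * zee β := by
  rw [zee, zee, autCard_cons α β k h]
  conv_lhs => rw [h]
  rw [Multiset.prod_cons]
  rw [← h]
  ring

theorem autCard_pos {d : ℕ} (α : d.Partition) : 0 < autCard α :=
  prod_pos fun _ _ => Nat.factorial_pos _

theorem zee_pos {d : ℕ} (α : d.Partition) : 0 < zee α :=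
  Nat.mul_pos (autCard_pos α) (Multiset.prod_pos fun _ h => α.parts_pos h)

variable {R : Type*} [CommRing R] [Algebra ℚ R]

/-- The value of the complete symmetric function `hₙ` at power sums `P`. -/
noncomputable def completeEval (P : ℕ → R) (n : ℕ) : R := MvPolynomial.aeval P (complete n)

theorem completeEval_eq (P : ℕ → R) (n : ℕ) : completeEval P n =
    ∑ α : n.Partition, ((zee α : ℚ)⁻¹) • (α.parts.map P).prod := by
  rw [completeEval, complete, map_sum]
  refine sum_congr rfl fun α _ => ?_
  rw [map_mul, MvPolynomial.aeval_C, map_multiset_prod, Multiset.map_map, Algebra.smul_def, zee]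
  congr 3
  exact funext fun k => MvPolynomial.aeval_X P k

theorem completeEval_zero (P : ℕ → R) : completeEval P 0 = 1 := by
  rw [completeEval_eq, Fintype.sum_unique]
  simp [zee, autCard]

/-- Removing one part `k` from a partition. -/
def erasePart {n : ℕ} (α : n.Partition) (k : ℕ) (hk : k ∈ α.parts) : (n - k).Partition where
  parts := α.parts.erase k
  parts_pos h := α.parts_pos (Multiset.mem_of_mem_erase h)
  parts_sum := by
    have := congrArg Multiset.sum (Multiset.cons_erase hk)
    rw [Multiset.sum_cons, α.parts_sum] at this
    omega

/-- Adding one part `k` to a partition. -/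
def addPart {n k : ℕ} (β : (n - k).Partition) (hk : 0 < k) (hkn : k ≤ n) : n.Partition where
  parts := k ::ₘ β.parts
  parts_pos {i} h := by
    rcases Multiset.mem_cons.mp h with h | h
    · exact h ▸ hk
    · exact β.parts_pos h
  parts_sum := by
    rw [Multiset.sum_cons, β.parts_sum]
    omega

theorem sum_partition_part (P : ℕ → R) (n k : ℕ) (hk : 0 < k) (hkn : k ≤ n) :
    ∑ α : n.Partition, ((k * α.parts.count k : ℕ) : ℚ) • ((zee α : ℚ)⁻¹) • (α.parts.map P).prod =
      P k * completeEval P (n - k) := by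
  rw [completeEval_eq, mul_sum, ← sum_filter_add_sum_filter_not _ (fun α => k ∈ α.parts)]
  rw [sum_eq_zero (s := univ.filter fun α : n.Partition => ¬ k ∈ α.parts), add_zero]
  · refine sum_bij' (fun α h => erasePart α k (mem_filter.mp h).2)
      (fun β _ => addPart β hk hkn) ?_ ?_ ?_ ?_ ?_
    · exact fun _ _ => mem_univ _
    · exact fun β _ => mem_filter.mpr ⟨mem_univ _, Multiset.mem_cons_self _ _⟩
    · intro α h
      exact Nat.Partition.ext (Multiset.cons_erase (mem_filter.mp h).2)
    · intro β _
      exact Nat.Partition.ext (Multiset.erase_cons_head _ _)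
    · intro α h
      have hα := (mem_filter.mp h).2
      have hcons : α.parts = k ::ₘ (erasePart α k hα).parts := (Multiset.cons_erase hα).symm
      have hz := zee_cons α (erasePart α k hα) k hcons
      have hc : 0 < α.parts.count k := Multiset.count_pos.mpr hα
      rw [smul_smul, hz]
      conv_lhs => rw [hcons, Multiset.map_cons, Multiset.prod_cons, ← hcons]
      rw [mul_smul_comm]
      congr 1
      have h1 : ((k * α.parts.count k : ℕ) : ℚ) ≠ 0 := by positivity
      rw [Nat.cast_mul (k * _), mul_inv, ← mul_assoc, mul_inv_cancel₀ h1, one_mul]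
  · intro α h
    rw [Multiset.count_eq_zero_of_notMem (mem_filter.mp h).2]
    simp

/-- Newton's recursion for the complete symmetric functions. -/
theorem natCast_mul_completeEval (P : ℕ → R) (n : ℕ) :
    (n : R) * completeEval P n = ∑ k ∈ Icc 1 n, P k * completeEval P (n - k) := by
  rw [sum_congr rfl fun k hk => (sum_partition_part P n k (mem_Icc.mp hk).1 (mem_Icc.mp hk).2).symm,
    sum_comm, completeEval_eq, mul_sum]
  refine sum_congr rfl fun α _ => ?_
  rw [← sum_smul, ← Nat.cast_sum]
  have : ∑ k ∈ Icc 1 n, k * α.parts.count k = n := by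
    conv_rhs => rw [← α.parts_sum]
    rw [sum_multiset_count_of_subset α.parts (Icc 1 n)]
    · exact sum_congr rfl fun k _ => by rw [smul_eq_mul, mul_comm]
    · intro k hk
      rw [Multiset.mem_toFinset] at hk
      exact mem_Icc.mpr ⟨α.parts_pos hk, α.parts_sum ▸ Multiset.le_sum_of_mem hk⟩
  rw [this, Nat.cast_smul_eq_nsmul, nsmul_eq_mul]

/-- Newton's recursion has a unique solution, as all positive integers are invertible. -/
theorem eq_completeEval_of_recursion (P : ℕ → R) (a : ℕ → R) (h0 : a 0 = 1)
    (h : ∀ n : ℕ, (n : R) * a n = ∑ k ∈ Icc 1 n, P k * a (n - k)) : a = completeEval P := by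
  funext n
  induction n using Nat.strong_induction_on with
  | _ n ih =>
    rcases Nat.eq_zero_or_pos n with rfl | hn
    · rw [h0, completeEval_zero]
    · have h1 : (n : R) * a n = n * completeEval P n := by
        rw [h, natCast_mul_completeEval]
        refine sum_congr rfl fun k hk => ?_
        rw [ih (n - k) (by have := mem_Icc.mp hk; omega)]
      have hu : IsUnit (n : R) := by
        have : IsUnit (n : ℚ) := isUnit_iff_ne_zero.mpr (by positivity)
        simpa using this.map (algebraMap ℚ R)
      exact hu.mul_left_cancel h1

/-- The generating series `∑ hₙ Tⁿ` at power sums `P`. -/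
noncomputable def completeSeries (P : ℕ → R) : PowerSeries R := PowerSeries.mk (completeEval P)

theorem X_mul_derivative_completeSeries (P : ℕ → R) :
    PowerSeries.X * PowerSeries.derivative R (completeSeries P) =
      (PowerSeries.mk fun k => if k = 0 then 0 else P k) * completeSeries P := by
  rw [X_mul_derivative_eq_iff]
  intro n
  simp only [completeSeries, PowerSeries.coeff_mk]
  exact natCast_mul_completeEval P n

/-- The series `∑ hₙ Tⁿ = exp (∑ Pₖ Tᵏ / k)` is characterized by its logarithmic derivative. -/
theorem eq_completeSeries (P : ℕ → R) (F : PowerSeries R) (h0 : PowerSeries.coeff 0 F = 1)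
    (h : PowerSeries.X * PowerSeries.derivative R F =
        (PowerSeries.mk fun k => if k = 0 then 0 else P k) * F) : F = completeSeries P := by
  ext n
  rw [X_mul_derivative_eq_iff] at h
  rw [completeSeries, PowerSeries.coeff_mk]
  exact congrFun (eq_completeEval_of_recursion P (fun n => PowerSeries.coeff n F) h0 h) n

/-- The exponential law `∑ hₙ[P + Q] Tⁿ = ∑ hₙ[P] Tⁿ · ∑ hₙ[Q] Tⁿ`, for finitely many summands. -/
theorem completeSeries_sum {ι : Type*} (s : Finset ι) (P : ι → ℕ → R) :
    completeSeries (fun k => ∑ a ∈ s, P a k) = ∏ a ∈ s, completeSeries (P a) := by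
  classical
  symm
  refine eq_completeSeries _ _ ?_ ?_
  · rw [PowerSeries.coeff_zero_eq_constantCoeff_apply, map_prod]
    refine prod_eq_one fun a _ => ?_
    rw [← PowerSeries.coeff_zero_eq_constantCoeff_apply, completeSeries, PowerSeries.coeff_mk,
      completeEval_zero]
  · rw [derivation_prod, mul_sum]
    have : (PowerSeries.mk fun k => if k = 0 then 0 else ∑ a ∈ s, P a k) =
        ∑ a ∈ s, PowerSeries.mk fun k => if k = 0 then 0 else P a k := by
      ext k
      rw [map_sum]
      simp only [PowerSeries.coeff_mk]
      split_ifs <;> simp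
    rw [this, sum_mul]
    refine sum_congr rfl fun a ha => ?_
    rw [mul_left_comm, X_mul_derivative_completeSeries, ← mul_prod_erase _ _ ha]
    ring

/-- Homogeneity of `hₙ`, with the power sum `Pₖ` in degree `k`. -/
theorem completeEval_mul_pow (P : ℕ → R) (c : R) (n : ℕ) :
    completeEval (fun k => P k * c ^ k) n = completeEval P n * c ^ n := by
  rw [completeEval_eq, completeEval_eq, sum_mul]
  refine sum_congr rfl fun α _ => ?_
  rw [Multiset.prod_map_mul, smul_mul_assoc]
  congr 2
  conv_rhs => rw [← α.parts_sum]
  induction α.parts using Multiset.induction_on with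
  | empty => simp
  | cons a s ih => rw [Multiset.map_cons, Multiset.prod_cons, ih, Multiset.sum_cons, pow_add]

theorem completeEval_one (n : ℕ) : completeEval (fun _ => (1 : R)) n = 1 := by
  refine (congrFun (eq_completeEval_of_recursion (fun _ => (1 : R)) (fun _ => 1) rfl ?_) n).symm
  intro n
  simp

theorem completeEval_pow (c : R) (n : ℕ) : completeEval (fun k => c ^ k) n = c ^ n := by
  have := completeEval_mul_pow (fun _ => (1 : R)) c n
  rwa [completeEval_one, one_mul, funext fun k => one_mul (c ^ k)] at this

end Complete

/-! ### Coefficients of alternants times power sums -/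

section Frobenius

variable {n d : ℕ}

/-- The power sum symmetric polynomial `p_α` in `n` variables. -/
noncomputable def powerSumPart (n : ℕ) (α : d.Partition) : MvPolynomial (Fin n) ℚ :=
  (α.parts.map fun k => ∑ a, MvPolynomial.X a ^ k).prod

/-- The coefficient of `x^m` in `det (x_i ^ j) p_α`. For the exponent `m` belonging to a partition
`λ`, Frobenius' formula says that it is the value of the character `χ^λ` at the class `α`. -/
noncomputable def frob (m : Fin n →₀ ℕ) (α : d.Partition) : ℚ :=
  (alternant n * powerSumPart n α).coeff m

variable {R : Type*} [CommRing R] [Algebra ℚ R]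

theorem map_completeEval {S : Type*} [CommRing S] [Algebra ℚ S] (f : R →ₐ[ℚ] S) (P : ℕ → R)
    (k : ℕ) : f (completeEval P k) = completeEval (fun i => f (P i)) k := by
  rw [completeEval, completeEval, MvPolynomial.aeval_def, MvPolynomial.aeval_def,
    ← AlgHom.coe_toRingHom, MvPolynomial.hom_eval₂]
  exact congrArg (fun g => MvPolynomial.eval₂ g _ _) f.comp_algebraMap

/-- The coefficient of `x^m` in the Cauchy kernel: evaluating `h_d` at the power sums `Pₖ ∑ x_aᵏ`
gives on one side the sum over `p_α`, and on the other the product of the series `∑ hₖ[P] x_aᵏ`. -/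
theorem sum_coeff_powerSumPart (P : ℕ → R) (m : Fin n →₀ ℕ) (hm : ∑ a, m a = d) :
    ∑ α : d.Partition, ((zee α : ℚ)⁻¹ * (powerSumPart n α).coeff m) • (α.parts.map P).prod =
      ∏ a, completeEval P (m a) := by
  have hC : ∀ k, (MvPolynomial.C (completeEval P k) : MvPolynomial (Fin n) R) =
      completeEval (fun i => MvPolynomial.C (P i)) k := fun k =>
    map_completeEval (IsScalarTower.toAlgHom ℚ R (MvPolynomial (Fin n) R)) P k
  have h1 : completeEval (fun k => ∑ a : Fin n, (MvPolynomial.C (P k) * MvPolynomial.X a ^ k :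
      MvPolynomial (Fin n) R)) d = ∑ l ∈ finsuppAntidiag univ d,
        MvPolynomial.monomial l (∏ a, completeEval P (l a)) := by
    have := congrArg (PowerSeries.coeff d) (completeSeries_sum univ
      fun (a : Fin n) k => (MvPolynomial.C (P k) * MvPolynomial.X a ^ k : MvPolynomial (Fin n) R))
    rw [completeSeries, PowerSeries.coeff_mk, PowerSeries.coeff_prod] at this
    rw [this]
    refine sum_congr rfl fun l _ => ?_
    rw [MvPolynomial.monomial_eq, Finsupp.prod_fintype _ _ (by simp), map_prod, ← prod_mul_distrib]
    refine prod_congr rfl fun a _ => ?_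
    rw [completeSeries, PowerSeries.coeff_mk, completeEval_mul_pow, hC]
  have h2 := congrArg (MvPolynomial.coeff m) h1
  rw [MvPolynomial.coeff_sum, completeEval_eq, MvPolynomial.coeff_sum,
    sum_eq_single_of_mem m (mem_finsuppAntidiag.mpr ⟨hm, subset_univ _⟩)] at h2
  · rw [MvPolynomial.coeff_monomial, if_pos rfl] at h2
    rw [← h2]
    refine sum_congr rfl fun α _ => ?_
    rw [MvPolynomial.coeff_smul, mul_smul]
    congr 1
    have h3 : (α.parts.map fun k => ∑ a : Fin n, (MvPolynomial.C (P k) * MvPolynomial.X a ^ k :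
        MvPolynomial (Fin n) R)).prod = MvPolynomial.C (α.parts.map P).prod *
          MvPolynomial.map (algebraMap ℚ R) (powerSumPart n α) := by
      rw [powerSumPart, map_multiset_prod, map_multiset_prod, Multiset.map_map, Multiset.map_map,
        ← Multiset.prod_map_mul]
      congr 1
      refine Multiset.map_congr rfl fun k _ => ?_
      simp [mul_sum]
    rw [h3, MvPolynomial.coeff_C_mul, MvPolynomial.coeff_map, Algebra.smul_def, mul_comm]
  · intro l _ hl
    rw [MvPolynomial.coeff_monomial, if_neg hl]

/-- The value of `hₖ` at power sums `P`, for an integer `k`. -/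
noncomputable def completeIntEval (P : ℕ → R) (k : ℤ) : R :=
  if 0 ≤ k then completeEval P k.toNat else 0

theorem aeval_completeInt (P : ℕ → R) (k : ℤ) :
    MvPolynomial.aeval P (completeInt k) = completeIntEval P k := by
  rw [completeInt, completeIntEval]
  split_ifs
  · rfl
  · exact map_zero _

theorem completeIntEval_sub (P : ℕ → R) (k l : ℕ) :
    completeIntEval P ((k : ℤ) - l) = if l ≤ k then completeEval P (k - l) else 0 := by
  rw [completeIntEval]
  refine if_congr (by omega) ?_ rfl
  congr 1
  omega

theorem sum_permExponent (w : Perm (Fin n)) : ∑ a, permExponent w a = ∑ a : Fin n, (a : ℕ) :=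
  Equiv.sum_comp w.symm fun a : Fin n => (a : ℕ)

/-- Frobenius' formula: the Jacobi-Trudi determinant expanded in power sums. -/
theorem sum_frob_smul (P : ℕ → R) (m : Fin n →₀ ℕ) (hm : ∑ a, m a = d + ∑ a : Fin n, (a : ℕ)) :
    ∑ α : d.Partition, ((zee α : ℚ)⁻¹ * frob m α) • (α.parts.map P).prod =
      (Matrix.of fun a b : Fin n => completeIntEval P ((m a : ℤ) - (b : ℕ))).det := by
  rw [Matrix.det_apply]
  have h1 : ∀ α : d.Partition, ((zee α : ℚ)⁻¹ * frob m α) • (α.parts.map P).prod =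
      ∑ w : Perm (Fin n), ((Perm.sign w : ℤ) : ℚ) • if permExponent w ≤ m then
        ((zee α : ℚ)⁻¹ * (powerSumPart n α).coeff (m - permExponent w)) • (α.parts.map P).prod
        else 0 := by
    intro α
    rw [frob, alternant_eq_sum, sum_mul, MvPolynomial.coeff_sum, mul_sum, sum_smul]
    refine sum_congr rfl fun w _ => ?_
    rw [MvPolynomial.coeff_monomial_mul']
    split_ifs
    · rw [smul_smul]
      congr 1
      ring
    · simp
  rw [sum_congr rfl fun α _ => h1 α, sum_comm]
  refine sum_congr rfl fun w _ => ?_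
  rw [← smul_sum, Units.smul_def, ← Int.cast_smul_eq_zsmul ℚ]
  congr 1
  have h2 : ∏ i, (Matrix.of fun a b : Fin n => completeIntEval P ((m a : ℤ) - (b : ℕ))) (w i) i =
      ∏ a, if permExponent w a ≤ m a then completeEval P (m a - permExponent w a) else 0 := by
    refine Eq.trans ?_ (Equiv.prod_comp w _)
    refine prod_congr rfl fun i _ => ?_
    rw [Matrix.of_apply, completeIntEval_sub]
    simp [permExponent]
  rw [h2]
  by_cases hw : permExponent w ≤ m
  · simp only [if_pos hw, if_pos (hw _)]
    rw [sum_coeff_powerSumPart]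
    · rfl
    · have := sum_permExponent w
      have h3 : ∑ a, (m - permExponent w) a + ∑ a, permExponent w a = ∑ a, m a := by
        rw [← sum_add_distrib]
        exact sum_congr rfl fun a _ => Nat.sub_add_cancel (hw a)
      omega
  · simp only [if_neg hw, sum_const_zero]
    obtain ⟨a, ha⟩ := not_forall.mp hw
    exact (prod_eq_zero (mem_univ a) (if_neg ha)).symm

/-- The series `∑ hₖ(x) Tᵏ` at the power sums of finitely many variables is `∏ 1 / (1 - x_a T)`. -/
theorem completeSeries_powerSum_mul (x : Fin n → R) :
    completeSeries (fun k => ∑ a, x a ^ k) *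
      ∏ a, (1 - PowerSeries.C (x a) * PowerSeries.X) = 1 := by
  rw [completeSeries_sum univ fun a k => x a ^ k, ← prod_mul_distrib]
  refine prod_eq_one fun a _ => ?_
  have : completeSeries (fun k => x a ^ k) = PowerSeries.mk fun k => x a ^ k :=
    congrArg PowerSeries.mk (funext fun k => completeEval_pow (x a) k)
  rw [this]
  ext k
  rw [mul_sub, mul_one, ← mul_assoc, map_sub]
  cases k with
  | zero => simp
  | succ k =>
    rw [PowerSeries.coeff_succ_mul_X, mul_comm, PowerSeries.coeff_C_mul]
    simp [pow_succ, mul_comm, PowerSeries.coeff_one]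

/-- Multiplying `∑ hᵣ(x) Tʳ` by all factors `1 - x_a T` but the `k`-th leaves `∑ x_kʳ Tʳ`. -/
theorem sum_completeIntEval_mul_coeff (x : Fin n → R) (k : Fin n) (r : ℕ) :
    ∑ b : Fin n, completeIntEval (fun k => ∑ a, x a ^ k) ((r : ℤ) - (b : ℕ)) *
      (∏ a ∈ univ.erase k, (1 - Polynomial.C (x a) * Polynomial.X)).coeff b = x k ^ r := by
  set G : Polynomial R := ∏ a ∈ univ.erase k, (1 - Polynomial.C (x a) * Polynomial.X) with hG
  have hdeg : ∀ b, n ≤ b → G.coeff b = 0 := by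
    intro b hb
    refine Polynomial.coeff_eq_zero_of_natDegree_lt ?_
    refine lt_of_le_of_lt (Polynomial.natDegree_prod_le _ _) ?_
    have : ∑ a ∈ univ.erase k, (1 - Polynomial.C (x a) * Polynomial.X).natDegree ≤
        ∑ _a ∈ univ.erase k, 1 := by
      refine sum_le_sum fun a _ => ?_
      refine (Polynomial.natDegree_sub_le _ _).trans ?_
      rw [Polynomial.natDegree_one]
      exact max_le zero_le_one ((Polynomial.natDegree_C_mul_le _ _).trans Polynomial.natDegree_X_le)
    rw [sum_const, card_erase_of_mem (mem_univ k), card_univ, Fintype.card_fin] at this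
    have := k.pos
    simp at *
    omega
  have hGser : (G : PowerSeries R) =
      ∏ a ∈ univ.erase k, (1 - PowerSeries.C (x a) * PowerSeries.X) := by
    rw [hG, ← Polynomial.coeToPowerSeries.ringHom_apply, map_prod]
    simp
  have hprod : completeSeries (fun k => ∑ a, x a ^ k) * (G : PowerSeries R) =
      PowerSeries.mk fun r => x k ^ r := by
    have h1 := completeSeries_powerSum_mul x
    rw [← mul_prod_erase univ _ (mem_univ k), ← hGser] at h1
    have h2 : (PowerSeries.mk fun r => x k ^ r) *
        (1 - PowerSeries.C (x k) * PowerSeries.X) = 1 := by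
      have := completeSeries_powerSum_mul (n := 1) fun _ => x k
      simpa [completeSeries, funext (completeEval_pow (x k))] using this
    calc _ = (PowerSeries.mk fun r => x k ^ r) * (1 - PowerSeries.C (x k) * PowerSeries.X) *
        (completeSeries (fun k => ∑ a, x a ^ k) * (G : PowerSeries R)) := by rw [h2, one_mul]
      _ = (PowerSeries.mk fun r => x k ^ r) * (completeSeries (fun k => ∑ a, x a ^ k) *
        ((1 - PowerSeries.C (x k) * PowerSeries.X) * (G : PowerSeries R))) := by ring
      _ = _ := by rw [h1, mul_one]
  have h := congrArg (PowerSeries.coeff r) hprod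
  rw [PowerSeries.coeff_mk, mul_comm, PowerSeries.coeff_mul,
    Nat.sum_antidiagonal_eq_sum_range_succ (fun i j => PowerSeries.coeff i (G : PowerSeries R) *
      PowerSeries.coeff j (completeSeries _))] at h
  rw [← h, Fin.sum_univ_eq_sum_range (fun b => completeIntEval (fun k => ∑ a, x a ^ k)
    ((r : ℤ) - (b : ℕ)) * G.coeff b) n]
  have e1 : ∑ b ∈ range n, completeIntEval (fun k => ∑ a, x a ^ k) ((r : ℤ) - (b : ℕ)) * G.coeff b =
      ∑ b ∈ range (n + r.succ), completeIntEval (fun k => ∑ a, x a ^ k) ((r : ℤ) - (b : ℕ)) *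
        G.coeff b := by
    refine sum_subset (range_subset_range.mpr (by omega)) fun b _ hb => ?_
    rw [hdeg b (by simpa using hb), mul_zero]
  have e2 : ∑ b ∈ range r.succ, PowerSeries.coeff b (G : PowerSeries R) *
      PowerSeries.coeff (r - b) (completeSeries fun k => ∑ a, x a ^ k) =
      ∑ b ∈ range r.succ, completeIntEval (fun k => ∑ a, x a ^ k) ((r : ℤ) - (b : ℕ)) *
        G.coeff b := by
    refine sum_congr rfl fun b hb => ?_
    have : b ≤ r := by simpa [Nat.lt_succ_iff] using hb
    rw [completeIntEval_sub, if_pos this, completeSeries, PowerSeries.coeff_mk,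
      Polynomial.coeff_coe, mul_comm]
  rw [e1, e2]
  symm
  refine sum_subset (range_subset_range.mpr (by omega)) fun b _ hb => ?_
  rw [completeIntEval_sub, if_neg (by simpa [Nat.lt_succ_iff] using hb), zero_mul]

theorem det_completeIntEval_self (P : ℕ → R) :
    (Matrix.of fun a b : Fin n => completeIntEval P (((a : ℕ) : ℤ) - (b : ℕ))).det = 1 := by
  rw [Matrix.det_of_isLowerTriangular]
  · refine prod_eq_one fun a _ => ?_
    rw [Matrix.of_apply, completeIntEval_sub, if_pos le_rfl, Nat.sub_self, completeEval_zero]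
  · intro a b hab
    rw [Matrix.of_apply, completeIntEval_sub, if_neg]
    simpa using hab

/-- The Jacobi-Trudi determinant in finitely many variables is a ratio of alternants. -/
theorem alternant_mul_det (m : Fin n → ℕ) :
    alternant n * (Matrix.of fun a b : Fin n =>
      completeIntEval (fun k => ∑ a : Fin n, (MvPolynomial.X a : MvPolynomial (Fin n) ℚ) ^ k)
        ((m a : ℤ) - (b : ℕ))).det =
      (Matrix.of fun a k : Fin n => (MvPolynomial.X k : MvPolynomial (Fin n) ℚ) ^ m a).det := by
  set M : Matrix (Fin n) (Fin n) (MvPolynomial (Fin n) ℚ) := Matrix.of fun b k =>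
    (∏ a ∈ univ.erase k, (1 - Polynomial.C (MvPolynomial.X a : MvPolynomial (Fin n) ℚ) *
      Polynomial.X)).coeff b
  have key : ∀ m : Fin n → ℕ, (Matrix.of fun a b : Fin n =>
      completeIntEval (fun k => ∑ a : Fin n, (MvPolynomial.X a : MvPolynomial (Fin n) ℚ) ^ k)
        ((m a : ℤ) - (b : ℕ))) * M =
      Matrix.of fun a k : Fin n => (MvPolynomial.X k : MvPolynomial (Fin n) ℚ) ^ m a := by
    intro m
    ext1 a k
    rw [Matrix.mul_apply]
    exact sum_completeIntEval_mul_coeff _ k (m a)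
  -- The exponents `m a = a` turn the matrix of complete functions into a unitriangular one.
  have hM : M.det = alternant n := by
    have := congrArg Matrix.det (key fun a => a)
    rw [Matrix.det_mul, det_completeIntEval_self, one_mul] at this
    rw [this, alternant, ← Matrix.det_transpose]
    rfl
  rw [← key m, Matrix.det_mul, hM, mul_comm]

/-- Among the exponents of the generalized alternant `det (x_k ^ m_a)`, the permutations of `m`,
only `m` itself is increasing. -/
theorem coeff_det_pow (m m' : Fin n →₀ ℕ) (hm : StrictMono m) (hm' : StrictMono m') :
    ((Matrix.of fun a k : Fin n => (MvPolynomial.X k : MvPolynomial (Fin n) ℚ) ^ m a).det).coeff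
      m' = if m = m' then 1 else 0 := by
  have h1 : ∀ w : Perm (Fin n), ∏ i, (Matrix.of fun a k : Fin n =>
      (MvPolynomial.X k : MvPolynomial (Fin n) ℚ) ^ m a) (w i) i =
        MvPolynomial.monomial (Finsupp.equivFunOnFinite.symm fun i => m (w i)) 1 := by
    intro w
    rw [MvPolynomial.monomial_eq, Finsupp.prod_fintype _ _ (by simp)]
    simp
  rw [Matrix.det_apply, MvPolynomial.coeff_sum, sum_eq_single 1]
  · rw [h1, MvPolynomial.coeff_smul, MvPolynomial.coeff_monomial]
    simp only [Perm.sign_one, one_smul, Perm.one_apply]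
    refine if_congr ?_ rfl rfl
    rw [Equiv.symm_apply_eq]
    exact ⟨fun h => DFunLike.coe_injective h, fun h => h ▸ rfl⟩
  · intro w _ hw
    rw [h1, MvPolynomial.coeff_smul, MvPolynomial.coeff_monomial, if_neg, smul_zero]
    intro h
    apply hw
    have hmono : StrictMono w := by
      intro i j hij
      have := hm' hij
      rw [← h] at this
      exact hm.lt_iff_lt.mp this
    exact Equiv.ext fun i => congrFun ((hmono.range_inj strictMono_id).mp
      (by rw [w.surjective.range_eq, Set.range_id])) i
  · simp

/-- Orthogonality of the rows of the character table. -/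
theorem sum_frob_mul_frob (m m' : Fin n →₀ ℕ) (hm : StrictMono m) (hm' : StrictMono m')
    (hd : ∑ a, m a = d + ∑ a : Fin n, (a : ℕ)) :
    ∑ α : d.Partition, (zee α : ℚ)⁻¹ * frob m α * frob m' α = if m = m' then 1 else 0 := by
  rw [← coeff_det_pow m m' hm hm', ← alternant_mul_det, ← sum_frob_smul _ m hd, mul_sum,
    MvPolynomial.coeff_sum]
  refine sum_congr rfl fun α _ => ?_
  rw [mul_smul_comm, MvPolynomial.coeff_smul, smul_eq_mul]
  rfl

end Frobenius

/-! ### Partitions as strictly increasing exponents -/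

section Shapes

variable {d : ℕ}

/-- The `i`-th row of a Young diagram (`i ≥ 0`), zero beyond the last one. -/
def row (lam : d.Partition) (i : ℕ) : ℕ := (rows lam).getD i 0

theorem coe_rows (lam : d.Partition) : (rows lam : Multiset ℕ) = lam.parts :=
  Multiset.sort_eq _ _

theorem length_rows_le (lam : d.Partition) : (rows lam).length ≤ d := by
  have h1 : (rows lam).length = lam.parts.card := by rw [← coe_rows, Multiset.coe_card]
  rw [h1]
  calc lam.parts.card = lam.parts.card • 1 := by simp
    _ ≤ lam.parts.sum := Multiset.card_nsmul_le_sum fun i hi => lam.parts_pos hi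
    _ = d := lam.parts_sum

theorem map_row_range (lam : d.Partition) (n : ℕ) (hn : (rows lam).length ≤ n) :
    (Multiset.range n).map (row lam) =
      lam.parts + Multiset.replicate (n - (rows lam).length) 0 := by
  obtain ⟨m, rfl⟩ := Nat.exists_eq_add_of_le hn
  rw [← coe_rows, ← Multiset.coe_range, Multiset.map_coe, ← Multiset.coe_replicate,
    Multiset.coe_add]
  congr 1
  refine List.ext_getElem (by simp) fun i h1 h2 => ?_
  rw [List.getElem_map, List.getElem_range, row, List.getD_eq_getElem?_getD, List.getElem_append]
  split_ifs with h
  · rw [List.getElem?_eq_getElem h]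
    rfl
  · rw [List.getElem?_eq_none (not_lt.mp h)]
    simp

theorem sum_row (lam : d.Partition) (f : ℕ → ℕ) (hf : f 0 = 0) :
    ∑ i ∈ range d, f (row lam i) = (lam.parts.map f).sum := by
  have := congrArg (fun s => (s.map f).sum) (map_row_range lam d (length_rows_le lam))
  rw [Multiset.map_add, Multiset.sum_add, Multiset.map_replicate, Multiset.sum_replicate, hf,
    smul_zero, add_zero, Multiset.map_map] at this
  exact this

theorem sum_range_row (lam : d.Partition) : ∑ i ∈ range d, row lam i = d := by
  have := sum_row lam id rfl
  rwa [Multiset.map_id, lam.parts_sum] at this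

theorem row_antitone (lam : d.Partition) : Antitone (row lam) := by
  intro i j hij
  have hs : (rows lam).Pairwise (· ≥ ·) := Multiset.pairwise_sort _ _
  rw [row, row, List.getD_eq_getElem?_getD, List.getD_eq_getElem?_getD]
  by_cases hj : j < (rows lam).length
  · rw [List.getElem?_eq_getElem hj, List.getElem?_eq_getElem (hij.trans_lt hj)]
    rcases hij.eq_or_lt with rfl | hlt
    · exact le_rfl
    · exact List.pairwise_iff_getElem.mp hs i j _ hj hlt
  · rw [List.getElem?_eq_none (not_lt.mp hj)]
    exact Nat.zero_le _

theorem row_le (lam : d.Partition) (i : ℕ) : row lam i ≤ d := by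
  rw [row, List.getD_eq_getElem?_getD]
  by_cases hi : i < (rows lam).length
  · rw [List.getElem?_eq_getElem hi]
    have : (rows lam)[i] ∈ lam.parts := by
      rw [← coe_rows]
      exact List.getElem_mem hi
    exact (Multiset.le_sum_of_mem this).trans_eq lam.parts_sum
  · rw [List.getElem?_eq_none (not_lt.mp hi)]
    exact Nat.zero_le _

theorem conjPart_eq (lam : d.Partition) (j : ℕ) (hj : 1 ≤ j) :
    conjPart lam j = ((range d).filter fun i => j ≤ row lam i).card := by
  have h := congrArg (fun s => (s.filter (fun i => j ≤ i)).card)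
    (map_row_range lam d (length_rows_le lam))
  simp only [Multiset.filter_add, Multiset.card_add] at h
  have h0 : (Multiset.replicate (d - (rows lam).length) 0).filter (fun i => j ≤ i) = 0 := by
    rw [Multiset.filter_eq_nil]
    intro a ha
    rw [Multiset.eq_of_mem_replicate ha]
    omega
  rw [h0, Multiset.card_zero, add_zero, Multiset.filter_map, Multiset.card_map] at h
  exact h.symm

theorem filter_row_eq_range (lam : d.Partition) (j : ℕ) :
    ((range d).filter fun i => j ≤ row lam i) =
      range ((range d).filter fun i => j ≤ row lam i).card := by
  set A := (range d).filter fun i => j ≤ row lam i with hA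
  have hlow : ∀ i ∈ A, ∀ k ≤ i, k ∈ A := by
    intro i hi k hk
    rw [hA, mem_filter, mem_range] at hi ⊢
    exact ⟨hk.trans_lt hi.1, hi.2.trans (row_antitone lam hk)⟩
  refine eq_of_subset_of_card_le (fun i hi => ?_) (by rw [card_range])
  rw [mem_range]
  have : range (i + 1) ⊆ A := fun k hk => hlow i hi k (Nat.lt_succ_iff.mp (mem_range.mp hk))
  have := card_le_card this
  rw [card_range] at this
  omega

/-- The content sum `∑ C(λ'ⱼ, 2) = ∑ i λᵢ`, with rows numbered from zero. -/
theorem sum_conjPart_choose (lam : d.Partition) :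
    ∑ j ∈ Icc 1 d, (conjPart lam j).choose 2 = ∑ i ∈ range d, i * row lam i := by
  have h1 : ∀ j ∈ Icc 1 d, (conjPart lam j).choose 2 =
      ∑ i ∈ range d, if j ≤ row lam i then i else 0 := by
    intro j hj
    rw [conjPart_eq lam j (mem_Icc.mp hj).1, ← sum_filter]
    conv_rhs => rw [filter_row_eq_range]
    rw [sum_range_id, Nat.choose_two_right]
  rw [sum_congr rfl h1, sum_comm]
  refine sum_congr rfl fun i _ => ?_
  rw [← sum_filter, sum_const, smul_eq_mul, mul_comm]
  congr 1
  have : (Icc 1 d).filter (fun j => j ≤ row lam i) = Icc 1 (row lam i) := by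
    ext j
    have := row_le lam i
    simp only [mem_filter, mem_Icc]
    omega
  rw [this, Nat.card_Icc, Nat.add_sub_cancel]

theorem two_mul_eta (lam : d.Partition) : 2 * (eta lam : ℚ) =
    ∑ i ∈ range d, ((row lam i : ℚ) ^ 2 - row lam i - 2 * i * row lam i) := by
  have h1 : (((lam.parts.map fun i => i.choose 2).sum : ℕ) : ℚ) =
      ∑ i ∈ range d, (row lam i : ℚ) * (row lam i - 1) / 2 := by
    rw [← sum_row lam (fun i => i.choose 2) rfl, Nat.cast_sum]
    exact sum_congr rfl fun i _ => Nat.cast_choose_two ℚ _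
  rw [eta, sum_conjPart_choose]
  rw [Int.cast_sub, Int.cast_natCast, Int.cast_natCast, h1, Nat.cast_sum, mul_sub,
    mul_sum, mul_sum, ← sum_sub_distrib]
  refine sum_congr rfl fun i _ => ?_
  push_cast
  ring

/-- The strictly increasing exponent `(λ_d, λ_{d-1} + 1, …, λ₁ + d - 1)`. -/
noncomputable def shifted (lam : d.Partition) : Fin d →₀ ℕ :=
  Finsupp.equivFunOnFinite.symm fun a => row lam (Fin.rev a) + a

theorem shifted_apply (lam : d.Partition) (a : Fin d) :
    shifted lam a = row lam (Fin.rev a) + a := rfl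

theorem shifted_strictMono (lam : d.Partition) : StrictMono (shifted lam) := by
  intro a b hab
  rw [shifted_apply, shifted_apply]
  exact add_lt_add_of_le_of_lt
    (row_antitone lam (Fin.le_def.mp (Fin.rev_le_rev.mpr hab.le))) hab

/-- A partition can be recovered from its shifted parts. -/
theorem shifted_injective : Function.Injective (shifted (d := d)) := by
  intro lam lam' h
  have h1 : ∀ i ∈ Multiset.range d, row lam i = row lam' i := by
    intro i hi
    have hi' : i < d := Multiset.mem_range.mp hi
    have := DFunLike.congr_fun h (Fin.rev ⟨i, hi'⟩)
    rw [shifted_apply, shifted_apply, Fin.rev_rev] at this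
    exact Nat.add_right_cancel this
  have h2 := Multiset.map_congr rfl h1
  rw [map_row_range _ _ (length_rows_le _), map_row_range _ _ (length_rows_le _)] at h2
  have h3 := congrArg (Multiset.filter (fun i => 0 < i)) h2
  have h4 : ∀ mu : d.Partition, Multiset.filter (fun i => 0 < i)
      (mu.parts + Multiset.replicate (d - (rows mu).length) 0) = mu.parts := by
    intro mu
    rw [Multiset.filter_add, Multiset.filter_eq_self.mpr fun i hi => mu.parts_pos hi,
      Multiset.filter_eq_nil.mpr, add_zero]
    intro a ha
    rw [Multiset.eq_of_mem_replicate ha]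
    exact lt_irrefl 0
  rw [h4, h4] at h3
  exact Nat.Partition.ext h3

theorem sum_shifted (lam : d.Partition) :
    ∑ a, shifted lam a = d + ∑ a : Fin d, (a : ℕ) := by
  simp only [shifted_apply]
  rw [sum_add_distrib]
  congr 1
  rw [← Equiv.sum_comp Fin.revPerm]
  simp only [Fin.revPerm_apply, Fin.rev_rev]
  rw [Fin.sum_univ_eq_sum_range (fun i => row lam i) d, sum_range_row]

/-- The eigenvalue of `coeff_alternant_mul_sum_swap` at the exponent of `λ` is `2 η(λ)`; the factor
`2` is there because every transposition is counted as `(i j)` and as `(j i)`. -/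
theorem sum_shifted_sq (lam : d.Partition) :
    ∑ a, (shifted lam a : ℚ) ^ 2 - ∑ a : Fin d, ((a : ℕ) : ℚ) ^ 2 - (2 * d - 1) * d =
      2 * eta lam := by
  have hd : ∑ i ∈ range d, (row lam i : ℚ) = d := by
    rw [← Nat.cast_sum, sum_range_row]
  rw [two_mul_eta, ← Equiv.sum_comp Fin.revPerm, ← Equiv.sum_comp Fin.revPerm
    (fun a : Fin d => ((a : ℕ) : ℚ) ^ 2), ← sum_sub_distrib]
  have h1 : ∀ a : Fin d, (shifted lam (Fin.revPerm a) : ℚ) ^ 2 -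
      ((Fin.revPerm a : ℕ) : ℚ) ^ 2 =
      ((row lam a : ℚ) ^ 2 - row lam a - 2 * (a : ℕ) * row lam a) + (2 * d - 1) * row lam a := by
    intro a
    have ha : ((Fin.rev a : ℕ) : ℚ) = d - 1 - (a : ℕ) := by
      rw [Fin.val_rev, Nat.cast_sub (by omega)]
      push_cast
      ring
    rw [Fin.revPerm_apply, shifted_apply, Fin.rev_rev]
    push_cast
    rw [ha]
    ring
  rw [sum_congr rfl fun a _ => h1 a, sum_add_distrib, ← mul_sum,
    Fin.sum_univ_eq_sum_range (fun i => (row lam i : ℚ)) d, hd,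
    Fin.sum_univ_eq_sum_range
      (fun i => (row lam i : ℚ) ^ 2 - row lam i - 2 * (i : ℕ) * row lam i) d]
  ring

theorem completeInt_of_neg {k : ℤ} (hk : k < 0) : completeInt k = 0 := if_neg (not_le.mpr hk)

theorem completeInt_zero : completeInt 0 = 1 := by
  have h := completeEval_zero (R := MvPolynomial ℕ ℚ) MvPolynomial.X
  rw [completeEval, MvPolynomial.aeval_X_left_apply] at h
  rw [completeInt, if_pos le_rfl]
  exact h

/-- Rows of length zero do not change the Jacobi-Trudi determinant. -/
theorem schur_eq_det (lam : d.Partition) (n : ℕ) (hn : (rows lam).length ≤ n) :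
    schur lam = (Matrix.of fun i j : Fin n =>
      completeInt ((row lam i : ℤ) - (i : ℕ) + (j : ℕ))).det := by
  obtain ⟨m, rfl⟩ := Nat.exists_eq_add_of_le hn
  have hz : ∀ i : Fin m, row lam ((rows lam).length + i) = 0 := by
    intro i
    rw [row, List.getD_eq_default _ _ (by omega)]
  have hblock : (Matrix.of fun i j : Fin ((rows lam).length + m) =>
      completeInt ((row lam i : ℤ) - (i : ℕ) + (j : ℕ))).submatrix finSumFinEquiv finSumFinEquiv =
      Matrix.fromBlocks
        (Matrix.of fun i j : Fin (rows lam).length =>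
          completeInt (((rows lam).get i : ℤ) - (i : ℕ) + (j : ℕ)))
        (Matrix.of fun (i : Fin (rows lam).length) (j : Fin m) =>
          completeInt (((rows lam).get i : ℤ) - (i : ℕ) + ((rows lam).length + j : ℕ)))
        0
        (Matrix.of fun i j : Fin m => completeInt ((j : ℤ) - (i : ℕ))) := by
    ext1 i j
    rcases i with i | i <;> rcases j with j | j
    · simp [row]
    · simp [row]
    · simp only [Matrix.submatrix_apply, Matrix.of_apply, finSumFinEquiv_apply_right,
        finSumFinEquiv_apply_left, Matrix.fromBlocks_apply₂₁, Fin.val_natAdd, Fin.val_castAdd,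
        Matrix.zero_apply, hz]
      exact completeInt_of_neg (by omega)
    · simp only [Matrix.submatrix_apply, Matrix.of_apply, finSumFinEquiv_apply_right,
        Matrix.fromBlocks_apply₂₂, Fin.val_natAdd, hz]
      congr 1
      push_cast
      ring
  rw [← Matrix.det_submatrix_equiv_self finSumFinEquiv, hblock, Matrix.det_fromBlocks_zero₂₁,
    Matrix.det_of_isUpperTriangular (M := Matrix.of fun i j : Fin m =>
      completeInt ((j : ℤ) - (i : ℕ)))]
  · rw [prod_eq_one fun i _ => by rw [Matrix.of_apply, sub_self, completeInt_zero], mul_one]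
    rfl
  · intro i j hij
    exact completeInt_of_neg (by simp at hij ⊢; omega)

/-- The Schur function in power sums, with coefficients the (Frobenius) character values. -/
theorem aeval_schur {R : Type*} [CommRing R] [Algebra ℚ R] (P : ℕ → R) (lam : d.Partition) :
    MvPolynomial.aeval P (schur lam) =
      ∑ α : d.Partition, ((zee α : ℚ)⁻¹ * frob (shifted lam) α) • (α.parts.map P).prod := by
  rw [sum_frob_smul P _ (sum_shifted lam), schur_eq_det lam d (length_rows_le lam),
    ← Matrix.det_submatrix_equiv_self Fin.revPerm, AlgHom.map_det]
  congr 1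
  ext1 a b
  rw [AlgHom.mapMatrix_apply, Matrix.map_apply, Matrix.submatrix_apply, Matrix.of_apply,
    aeval_completeInt, Matrix.of_apply, shifted_apply]
  congr 1
  rw [Fin.revPerm_apply, Fin.revPerm_apply, Fin.val_rev b, Fin.val_rev a]
  omega

end Shapes

/-! ### Orthogonality and central characters -/

section Characters

variable {d : ℕ}

theorem sum_frob_shifted_mul_frob_row (lam mu : d.Partition) :
    ∑ α : d.Partition, (zee α : ℚ)⁻¹ * frob (shifted lam) α * frob (shifted mu) α =
      if lam = mu then 1 else 0 := by
  rw [sum_frob_mul_frob _ _ (shifted_strictMono lam) (shifted_strictMono mu) (sum_shifted lam)]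
  exact if_congr shifted_injective.eq_iff rfl rfl

/-- Orthogonality of the columns of the character table. -/
theorem sum_frob_shifted_mul_frob_column (α β : d.Partition) :
    ∑ lam : d.Partition, (zee α : ℚ)⁻¹ * frob (shifted lam) α * frob (shifted lam) β =
      if α = β then 1 else 0 := by
  have h : (Matrix.of fun lam α : d.Partition => (zee α : ℚ)⁻¹ * frob (shifted lam) α) *
      (Matrix.of fun α lam : d.Partition => frob (shifted lam) α) = 1 := by
    ext1 lam mu
    rw [Matrix.mul_apply, Matrix.one_apply, ← sum_frob_shifted_mul_frob_row lam mu]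
    rfl
  have h' := congrArg (fun M => M β α) (mul_eq_one_comm.mp h)
  rw [Matrix.mul_apply, Matrix.one_apply] at h'
  rw [show (if α = β then (1 : ℚ) else 0) = if β = α then 1 else 0 from if_congr eq_comm rfl rfl,
    ← h']
  refine sum_congr rfl fun lam _ => ?_
  simp only [Matrix.of_apply]
  ring

theorem exists_partition_eq (σ : Perm (Fin d)) :
    ∃ α : d.Partition, σ.partition.parts = α.parts :=
  ⟨⟨σ.partition.parts, σ.partition.parts_pos, by
    rw [σ.partition.parts_sum, Fintype.card_fin]⟩, rfl⟩

/-- The character value `χ^λ(σ)`, as in `frob`, at the cycle type of a permutation `σ`. -/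
noncomputable def frobPerm (lam : d.Partition) (σ : Perm (Fin d)) : ℚ :=
  (alternant d * powerSum d σ).coeff (shifted lam)

theorem frobPerm_eq (lam α : d.Partition) (σ : Perm (Fin d)) (h : σ.partition.parts = α.parts) :
    frobPerm lam σ = frob (shifted lam) α := by
  rw [frobPerm, frob, powerSum, cycleWeight, powerSumPart, h]

open Classical in
/-- The transpositions of a finite set. -/
noncomputable def swaps (V : Type*) [Fintype V] [DecidableEq V] : Finset (Perm V) :=
  univ.filter Perm.IsSwap

theorem mem_swaps {V : Type*} [Fintype V] [DecidableEq V] {τ : Perm V} :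
    τ ∈ swaps V ↔ τ.IsSwap := by simp [swaps]

theorem sum_swaps (F : Perm (Fin d) → ℚ) :
    ∑ i, ∑ j ∈ univ.erase i, F (swap i j) = 2 * ∑ τ ∈ swaps (Fin d), F τ := by
  rw [← sum_ltPairs (fun i j => F (swap i j)), mul_sum]
  refine sum_bij (fun w _ => swap w.1 w.2) ?_ ?_ ?_ ?_
  · intro w hw
    exact mem_swaps.mpr ⟨w.1, w.2, (mem_filter.mp hw).2.ne, rfl⟩
  · rintro ⟨i, j⟩ hw ⟨k, l⟩ hw' h
    have h1 : i < j := (mem_filter.mp hw).2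
    have h2 : k < l := (mem_filter.mp hw').2
    simp only at h
    have e1 := congrArg (fun f => f i) h
    have e2 := congrArg (fun f => f j) h
    simp only [swap_apply_left, swap_apply_right, swap_apply_def] at e1 e2
    ext <;> simp only <;> grind
  · intro τ hτ
    obtain ⟨i, j, hij, rfl⟩ := mem_swaps.mp hτ
    rcases hij.lt_or_gt with h | h
    · exact ⟨(i, j), mem_filter.mpr ⟨mem_univ _, h⟩, rfl⟩
    · exact ⟨(j, i), mem_filter.mpr ⟨mem_univ _, h⟩, swap_comm _ _⟩
  · intro w _
    rw [swap_comm w.2 w.1]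
    ring

/-- The class of transpositions acts on the character `χ^λ` as the content `η(λ)`. -/
theorem sum_frobPerm_swap_mul (lam : d.Partition) (σ : Perm (Fin d)) :
    ∑ τ ∈ swaps (Fin d), frobPerm lam (τ * σ) = eta lam * frobPerm lam σ := by
  have h := coeff_alternant_mul_sum_swap σ (shifted lam)
  rw [Fintype.card_fin, sum_shifted_sq, mul_sum, MvPolynomial.coeff_sum] at h
  simp only [mul_sum, MvPolynomial.coeff_sum] at h
  have h2 := sum_swaps fun τ => frobPerm lam (τ * σ)
  simp only [frobPerm] at h2 ⊢
  rw [h2] at h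
  linarith

/-- A conjugacy class of the symmetric group has `d! / z_β` elements. -/
theorem card_perm_mul_zee (β : d.Partition) :
    ((univ.filter fun σ : Perm (Fin d) => σ.partition.parts = β.parts).card) * zee β =
      d.factorial := by
  set m := β.parts.filter (2 ≤ ·) with hm
  have hparts : β.parts = m + Multiset.replicate (d - m.sum) 1 := by
    have h1 : β.parts = m + β.parts.filter (fun i => ¬ 2 ≤ i) :=
      (Multiset.filter_add_not _ _).symm
    have h2 : β.parts.filter (fun i => ¬ 2 ≤ i) =
        Multiset.replicate (β.parts.filter (fun i => ¬ 2 ≤ i)).card 1 := by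
      rw [Multiset.eq_replicate]
      refine ⟨rfl, fun b hb => ?_⟩
      have := β.parts_pos (Multiset.mem_filter.mp hb).1
      have := (Multiset.mem_filter.mp hb).2
      omega
    have h3 := congrArg Multiset.sum h1
    rw [β.parts_sum, h2, Multiset.sum_add, Multiset.sum_replicate, smul_eq_mul, mul_one] at h3
    rw [show d - m.sum = (β.parts.filter (fun i => ¬ 2 ≤ i)).card by omega, ← h2]
    exact h1
  have hle : m.sum ≤ d := by
    have := congrArg Multiset.sum hparts
    rw [β.parts_sum, Multiset.sum_add] at this
    omega
  have h2m : ∀ a ∈ m, 2 ≤ a := fun a ha => (Multiset.mem_filter.mp ha).2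
  have h1m : 1 ∉ m := fun h => by have := h2m 1 h; omega
  -- The cycle type of a permutation in Mathlib omits the fixed points.
  have hset : (univ.filter fun σ : Perm (Fin d) => σ.partition.parts = β.parts) =
      univ.filter fun σ : Perm (Fin d) => σ.cycleType = m := by
    refine filter_congr fun σ _ => ⟨fun h => ?_, fun h => ?_⟩
    · rw [← Perm.filter_parts_partition_eq_cycleType, h]
    · rw [Perm.parts_partition, ← Perm.sum_cycleType, h, hparts, Fintype.card_fin]
  have hz : zee β = (d - m.sum).factorial * m.prod * ∏ k ∈ m.toFinset, (m.count k).factorial := by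
    have hprod : β.parts.prod = m.prod := by
      rw [hparts, Multiset.prod_add, Multiset.prod_replicate, one_pow, mul_one]
    have haut : autCard β = (d - m.sum).factorial * ∏ k ∈ m.toFinset, (m.count k).factorial := by
      have hsub : β.parts.toFinset ⊆ insert 1 m.toFinset := by
        intro i hi
        rw [Multiset.mem_toFinset, hparts, Multiset.mem_add] at hi
        rcases hi with hi | hi
        · exact mem_insert_of_mem (Multiset.mem_toFinset.mpr hi)
        · rw [Multiset.eq_of_mem_replicate hi]
          exact mem_insert_self _ _
      rw [autCard, prod_subset hsub fun i _ hi => by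
        rw [Multiset.count_eq_zero_of_notMem (fun h => hi (Multiset.mem_toFinset.mpr h)),
          Nat.factorial_zero], prod_insert (by simpa using h1m)]
      congr 1
      · rw [hparts, Multiset.count_add, Multiset.count_eq_zero_of_notMem h1m, zero_add,
          Multiset.count_replicate_self]
      · refine prod_congr rfl fun i hi => ?_
        have : i ≠ 1 := fun h => h1m (h ▸ Multiset.mem_toFinset.mp hi)
        conv_lhs => rw [hparts]
        rw [Multiset.count_add, Multiset.count_replicate, if_neg this.symm, add_zero]
    rw [zee, haut, hprod]
    ring
  have := Perm.card_of_cycleType_mul_eq (Fin d) m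
  rw [Fintype.card_fin, if_pos ⟨hle, h2m⟩] at this
  rw [hset, hz, ← this]

end Characters

/-! ### Sums over words -/

section Words

variable {G A : Type*} [AddCommMonoid A]

/-- The sum of `φ` over the words of length `r` in the alphabet `S`. -/
def wordSum (S : Finset G) : ℕ → (List G → A) → A
  | 0, φ => φ []
  | r + 1, φ => ∑ g ∈ S, wordSum S r fun L => φ (g :: L)

theorem wordSum_congr (S : Finset G) {r : ℕ} {φ ψ : List G → A}
    (h : ∀ L, (∀ g ∈ L, g ∈ S) → φ L = ψ L) : wordSum S r φ = wordSum S r ψ := by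
  induction r generalizing φ ψ with
  | zero => exact h [] (by simp)
  | succ r ih =>
    exact sum_congr rfl fun g hg => ih fun L hL => h _ (by simpa [hg] using hL)

theorem sum_wordSum {ι : Type*} (s : Finset ι) (S : Finset G) (r : ℕ) (φ : ι → List G → A) :
    ∑ i ∈ s, wordSum S r (φ i) = wordSum S r fun L => ∑ i ∈ s, φ i L := by
  induction r generalizing φ with
  | zero => rfl
  | succ r ih =>
    simp only [wordSum]
    rw [sum_comm]
    exact sum_congr rfl fun g _ => ih fun i L => φ i (g :: L)

theorem map_wordSum {B F : Type*} [AddCommMonoid B] [FunLike F A B] [AddMonoidHomClass F A B]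
    (f : F) (S : Finset G) (r : ℕ) (φ : List G → A) :
    f (wordSum S r φ) = wordSum S r fun L => f (φ L) := by
  induction r generalizing φ with
  | zero => rfl
  | succ r ih =>
    rw [wordSum, map_sum]
    exact sum_congr rfl fun g _ => ih _

theorem wordSum_eq_sum_ofFn [Fintype G] [DecidableEq G] (S : Finset G) (r : ℕ) (φ : List G → A) :
    wordSum S r φ = ∑ τ : Fin r → G with ∀ i, τ i ∈ S, φ (List.ofFn τ) := by
  induction r generalizing φ with
  | zero => simp [wordSum]
  | succ r ih =>
    rw [wordSum, sum_filter, ← (Fin.consEquiv fun _ => G).sum_comp, Fintype.sum_prod_type,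
      ← sum_subset (subset_univ S)]
    · refine sum_congr rfl fun g hg => ?_
      rw [ih, sum_filter]
      refine sum_congr rfl fun τ _ => ?_
      simp [Fin.consEquiv, Fin.forall_fin_succ, hg, List.ofFn_succ]
    · intro g _ hg
      refine sum_eq_zero fun τ _ => if_neg fun h => hg ?_
      simpa [Fin.consEquiv] using h 0

/-- An eigenfunction of the sum of the letters is multiplied by `η ^ r` under words of length
`r`. -/
theorem wordSum_eigen {G : Type*} [Monoid G] (S : Finset G) (F : G → ℚ) (η : ℚ)
    (h : ∀ σ, ∑ g ∈ S, F (g * σ) = η * F σ) (r : ℕ) (σ : G) :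
    wordSum S r (fun L => F (L.reverse.prod * σ)) = η ^ r * F σ := by
  induction r generalizing σ with
  | zero => simp [wordSum]
  | succ r ih =>
    rw [wordSum]
    simp only [List.reverse_cons, List.prod_append, List.prod_singleton, mul_assoc]
    rw [sum_congr rfl fun g _ => ih (g * σ), ← mul_sum, h, pow_succ]
    ring

end Words

/-! ### The Frobenius count of factorizations -/

section Count

variable {d : ℕ}

/-- A tuple count, with an extra condition `Q` on the permutations, as a sum over words. -/
theorem card_eq_wordSum (r : ℕ) (α β : d.Partition)
    (Q : Perm (Fin d) → List (Perm (Fin d)) → Prop) [∀ σ L, Decidable (Q σ L)] :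
    (Nat.card {x : Perm (Fin d) × (Fin r → Perm (Fin d)) × Perm (Fin d) //
      IsFactorization α β x.1 x.2.1 x.2.2 ∧ Q x.1 (List.ofFn x.2.1)} : ℚ) =
    ∑ σ : Perm (Fin d), if σ.partition.parts = β.parts then
      wordSum (swaps (Fin d)) r fun L =>
        if (L.reverse.prod * σ).partition.parts = α.parts ∧ Q σ L then (1 : ℚ) else 0
      else 0 := by
  classical
  rw [Nat.card_eq_fintype_card, Fintype.card_subtype, ← sum_boole, Fintype.sum_prod_type]
  refine sum_congr rfl fun σ _ => ?_
  rw [Fintype.sum_prod_type, wordSum_eq_sum_ofFn, sum_filter]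
  split_ifs with hσ
  · refine sum_congr rfl fun τ _ => ?_
    rw [sum_eq_single ((List.ofFn τ).reverse.prod * σ)]
    · rw [← ite_and]
      refine if_congr ?_ rfl rfl
      simp only [IsFactorization, mem_swaps, hσ, true_and, and_true]
      tauto
    · exact fun γ _ hγ => if_neg fun h => hγ h.1.2.2.2.symm
    · simp
  · exact sum_eq_zero fun τ _ => sum_eq_zero fun γ _ => if_neg fun h => hσ h.1.1

/-- The number of factorizations in terms of characters. -/
theorem factorizationCount_eq (r : ℕ) (α β : d.Partition) :
    (factorizationCount r α β : ℚ) = d.factorial * ∑ lam : d.Partition, (eta lam : ℚ) ^ r *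
      ((zee α : ℚ)⁻¹ * frob (shifted lam) α) * ((zee β : ℚ)⁻¹ * frob (shifted lam) β) := by
  have h1 := card_eq_wordSum r α β fun _ _ => True
  simp only [and_true] at h1
  have hind : ∀ γ : Perm (Fin d), (if γ.partition.parts = α.parts then (1 : ℚ) else 0) =
      ∑ lam : d.Partition, (zee α : ℚ)⁻¹ * frob (shifted lam) α * frobPerm lam γ := by
    intro γ
    obtain ⟨γ', hγ'⟩ := exists_partition_eq γ
    rw [sum_congr rfl fun lam _ => by rw [frobPerm_eq lam γ' γ hγ'],
      sum_frob_shifted_mul_frob_column, hγ']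
    exact if_congr ⟨fun h => (Nat.Partition.ext h).symm, fun h => by rw [h]⟩ rfl rfl
  have hcard : ((univ.filter fun σ : Perm (Fin d) => σ.partition.parts = β.parts).card : ℚ) =
      d.factorial * (zee β : ℚ)⁻¹ := by
    have hz : (zee β : ℚ) ≠ 0 := Nat.cast_ne_zero.mpr (zee_pos β).ne'
    rw [← card_perm_mul_zee β, Nat.cast_mul, mul_assoc, mul_inv_cancel₀ hz, mul_one]
  rw [factorizationCount, h1, ← sum_filter]
  have h2 : ∀ σ ∈ univ.filter fun σ : Perm (Fin d) => σ.partition.parts = β.parts,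
      (wordSum (swaps (Fin d)) r fun L =>
        if (L.reverse.prod * σ).partition.parts = α.parts then (1 : ℚ) else 0) =
      ∑ lam : d.Partition, (eta lam : ℚ) ^ r * ((zee α : ℚ)⁻¹ * frob (shifted lam) α) *
        frob (shifted lam) β := by
    intro σ hσ
    simp only [hind]
    rw [← sum_wordSum]
    refine sum_congr rfl fun lam _ => ?_
    rw [← frobPerm_eq lam β σ (mem_filter.mp hσ).2]
    have := map_wordSum (AddMonoidHom.mulLeft ((zee α : ℚ)⁻¹ * frob (shifted lam) α))
      (swaps (Fin d)) r fun L => frobPerm lam (L.reverse.prod * σ)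
    simp only [AddMonoidHom.coe_mulLeft] at this
    rw [← this, wordSum_eigen _ _ _ (sum_frobPerm_swap_mul lam)]
    ring
  rw [sum_congr rfl h2, sum_const, nsmul_eq_mul, hcard, mul_assoc, mul_sum]
  congr 1
  refine sum_congr rfl fun lam _ => ?_
  ring

end Count

/-! ### Invariant sets and orbits -/

section Orbits

variable {V : Type*}

/-- The set `T` is mapped into itself by all permutations in the list. -/
def Preserves (L : List (Perm V)) (T : Set V) : Prop := ∀ g ∈ L, ∀ v ∈ T, g v ∈ T

/-- There is no proper nonempty invariant set. For finitely many points, this is the transitivity of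
the group generated by the list. -/
def NoInvariant (L : List (Perm V)) : Prop :=
  ∀ T : Set V, T.Nonempty → Preserves L T → T = Set.univ

/-- `S` is the smallest invariant set containing `v₀`. -/
def IsOrbit (L : List (Perm V)) (v₀ : V) (S : Set V) : Prop :=
  v₀ ∈ S ∧ Preserves L S ∧ ∀ T, v₀ ∈ T → Preserves L T → S ⊆ T

/-- The intersection of all invariant sets that contain `v₀`. -/
theorem existsUnique_isOrbit (L : List (Perm V)) (v₀ : V) : ∃! S, IsOrbit L v₀ S := by
  refine ⟨{v | ∀ T, v₀ ∈ T → Preserves L T → v ∈ T}, ⟨fun T h _ => h, ?_, ?_⟩, ?_⟩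
  · exact fun g hg v hv T h0 hT => hT g hg v (hv T h0 hT)
  · exact fun T h0 hT v hv => hv T h0 hT
  · rintro S ⟨h0, hS, hmin⟩
    refine Set.Subset.antisymm (fun v hv T h0 hT => hmin T h0 hT hv) fun v hv => hv S h0 hS

/-- On finitely many points, a permutation preserves the complements of its invariant sets. -/
theorem Preserves.compl [Finite V] {L : List (Perm V)} {T : Set V} (h : Preserves L T) :
    Preserves L Tᶜ := by
  intro g hg v hv hgv
  have := Equiv.Perm.perm_symm_mapsTo_of_mapsTo g (h g hg) hgv
  exact hv (by simpa using this)

end Orbits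

/-! ### Permutations of a disjoint union -/

section Splitting

variable {A B V : Type*} (e : A ⊕ B ≃ V)

/-- The permutation of `V = A ⊔ B` that is `g` on `A` and `h` on `B`. -/
def join (g : Perm A) (h : Perm B) : Perm V := e.permCongr (Perm.sumCongr g h)

theorem join_inl (g : Perm A) (h : Perm B) (a : A) :
    join e g h (e (Sum.inl a)) = e (Sum.inl (g a)) := by simp [join]

theorem join_inr (g : Perm A) (h : Perm B) (b : B) :
    join e g h (e (Sum.inr b)) = e (Sum.inr (h b)) := by simp [join]

theorem perm_ext_sum {f g : Perm V} (h1 : ∀ a, f (e (Sum.inl a)) = g (e (Sum.inl a)))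
    (h2 : ∀ b, f (e (Sum.inr b)) = g (e (Sum.inr b))) : f = g := by
  ext v
  obtain ⟨a | b, rfl⟩ := e.surjective v
  · exact h1 a
  · exact h2 b

theorem join_mul (g g' : Perm A) (h h' : Perm B) :
    join e (g * g') (h * h') = join e g h * join e g' h' :=
  perm_ext_sum e (by simp [join_inl]) (by simp [join_inr])

theorem join_injective : Function.Injective fun x : Perm A × Perm B => join e x.1 x.2 := by
  rintro ⟨g, h⟩ ⟨g', h'⟩ heq
  simp only at heq
  ext x
  · have := congrArg (fun f => f (e (Sum.inl x))) heq
    simpa [join_inl] using this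
  · have := congrArg (fun f => f (e (Sum.inr x))) heq
    simpa [join_inr] using this

theorem exists_join [Finite A] [Finite B] (f : Perm V)
    (hf : ∀ v ∈ Set.range (e ∘ Sum.inl), f v ∈ Set.range (e ∘ Sum.inl)) :
    ∃ g h, f = join e g h := by
  have hmaps : Set.MapsTo (e.symm.permCongr f) (Set.range (Sum.inl : A → A ⊕ B))
      (Set.range (Sum.inl : A → A ⊕ B)) := by
    rintro _ ⟨a, rfl⟩
    obtain ⟨a', ha'⟩ := hf _ ⟨a, rfl⟩
    exact ⟨a', by simp at ha' ⊢; rw [← ha', e.symm_apply_apply]⟩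
  obtain ⟨⟨g, h⟩, hgh⟩ := Perm.mem_sumCongrHom_range_of_perm_mapsTo_inl hmaps
  refine ⟨g, h, ?_⟩
  rw [Perm.sumCongrHom_apply] at hgh
  rw [join, hgh]
  ext v
  simp

theorem join_swap_left [DecidableEq A] [DecidableEq V] (a a' : A) :
    join e (swap a a') 1 = swap (e (Sum.inl a)) (e (Sum.inl a')) := by
  refine perm_ext_sum e (fun x => ?_) fun x => ?_
  · rw [join_inl, swap_apply_def, swap_apply_def]
    simp only [e.injective.eq_iff, Sum.inl.injEq]
    split_ifs <;> rfl
  · rw [join_inr, swap_apply_of_ne_of_ne] <;> simp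

theorem join_swap_right [DecidableEq B] [DecidableEq V] (b b' : B) :
    join e 1 (swap b b') = swap (e (Sum.inr b)) (e (Sum.inr b')) := by
  refine perm_ext_sum e (fun x => ?_) fun x => ?_
  · rw [join_inl, swap_apply_of_ne_of_ne] <;> simp
  · rw [join_inr, swap_apply_def, swap_apply_def]
    simp only [e.injective.eq_iff, Sum.inr.injEq]
    split_ifs <;> rfl

/-- A letter on one of the two sides, as a permutation of the whole. -/
def letter : Perm A ⊕ Perm B → Perm V := Sum.elim (fun g => join e g 1) fun h => join e 1 h

/-- The summand `A` is the orbit of one of its points exactly if the restriction of the list to `A`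
is transitive. -/
theorem isOrbit_join_iff [Finite A] (w : List (Perm A ⊕ Perm B)) (g : Perm A) (h : Perm B) (a : A) :
    IsOrbit (join e g h :: w.map (letter e)) (e (Sum.inl a)) (Set.range (e ∘ Sum.inl)) ↔
      NoInvariant (g :: w.filterMap Sum.getLeft?) := by
  constructor
  · rintro ⟨-, -, hmin⟩
    have key : ∀ T : Set A, a ∈ T → Preserves (g :: w.filterMap Sum.getLeft?) T →
        T = Set.univ := by
      intro T ha hT
      rw [Set.eq_univ_iff_forall]
      intro x
      have := hmin ((e ∘ Sum.inl) '' T) ⟨a, ha, rfl⟩ ?_ ⟨x, rfl⟩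
      · obtain ⟨y, hy, hxy⟩ := this
        have : y = x := by simpa using hxy
        exact this ▸ hy
      · intro f hf v hv
        obtain ⟨y, hy, rfl⟩ := hv
        rcases List.mem_cons.mp hf with rfl | hf
        · exact ⟨g y, hT g (by simp) y hy, (join_inl e g h y).symm⟩
        · obtain ⟨l | l, hl, rfl⟩ := List.mem_map.mp hf
          · refine ⟨l y, hT l ?_ y hy, (join_inl e l 1 y).symm⟩
            exact List.mem_cons_of_mem _ (List.mem_filterMap.mpr ⟨_, hl, rfl⟩)
          · exact ⟨y, hy, (join_inl e 1 l y).symm⟩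
    intro T hne hT
    by_cases ha : a ∈ T
    · exact key T ha hT
    · obtain ⟨y, hy⟩ := hne
      have := key Tᶜ ha hT.compl
      exact absurd hy (Set.eq_univ_iff_forall.mp this y)
  · intro hno
    refine ⟨⟨a, rfl⟩, ?_, ?_⟩
    · rintro f hf _ ⟨y, rfl⟩
      rcases List.mem_cons.mp hf with rfl | hf
      · exact ⟨g y, (join_inl e g h y).symm⟩
      · obtain ⟨l | l, hl, rfl⟩ := List.mem_map.mp hf
        · exact ⟨l y, (join_inl e l 1 y).symm⟩
        · exact ⟨y, (join_inl e 1 l y).symm⟩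
    · intro T ha hT
      have := hno ((e ∘ Sum.inl) ⁻¹' T) ⟨a, ha⟩ ?_
      · rintro _ ⟨y, rfl⟩
        exact Set.eq_univ_iff_forall.mp this y
      · intro f hf y hy
        rcases List.mem_cons.mp hf with rfl | hf
        · have := hT _ List.mem_cons_self _ hy
          rwa [Function.comp_apply, join_inl] at this
        · obtain ⟨l | l, hl, hlf⟩ := List.mem_filterMap.mp hf
          · obtain rfl : l = f := by simpa using hlf
            have := hT _ (List.mem_cons_of_mem _ (List.mem_map.mpr ⟨_, hl, rfl⟩)) _ hy
            rwa [Function.comp_apply, letter, Sum.elim_inl, join_inl] at this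
          · simp at hlf

theorem letter_injOn [Fintype A] [DecidableEq A] [Fintype B] [DecidableEq B] :
    Set.InjOn (letter e) ((swaps A).disjSum (swaps B) : Finset (Perm A ⊕ Perm B)) := by
  have hne : ∀ (g : Perm A) (h : Perm B), g ∈ swaps A → join e g 1 ≠ join e 1 h := by
    intro g h hg heq
    have := join_injective e (a₁ := (g, 1)) (a₂ := (1, h)) heq
    obtain ⟨x, y, hxy, rfl⟩ := mem_swaps.mp hg
    exact hxy (swap_eq_one_iff.mp (congrArg Prod.fst this))
  rintro (g | h) hg (g' | h') hg' heq
  · have := join_injective e (a₁ := (g, 1)) (a₂ := (g', 1)) heq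
    exact congrArg Sum.inl (congrArg Prod.fst this)
  · exact absurd heq (hne g h' (inl_mem_disjSum.mp (mem_coe.mp hg)))
  · exact absurd heq.symm (hne g' h (inl_mem_disjSum.mp (mem_coe.mp hg')))
  · have := join_injective e (a₁ := (1, h)) (a₂ := (1, h')) heq
    exact congrArg Sum.inr (congrArg Prod.snd this)

/-- The product of a shuffled word is computed separately on the two sides. -/
theorem reverse_prod_letter (w : List (Perm A ⊕ Perm B)) (g : Perm A) (h : Perm B) :
    (w.map (letter e)).reverse.prod * join e g h =
      join e ((w.filterMap Sum.getLeft?).reverse.prod * g)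
        ((w.filterMap Sum.getRight?).reverse.prod * h) := by
  induction w generalizing g h with
  | nil => simp
  | cons x w ih =>
    rcases x with x | x
    · simp only [List.map_cons, List.reverse_cons, List.prod_append, List.prod_singleton, mul_assoc,
        letter, Sum.elim_inl, ← join_mul, one_mul]
      rw [show (Sum.elim (fun g => join e g 1) fun h => join e 1 h) = letter e from rfl, ih]
      simp [List.filterMap_cons, mul_assoc]
    · simp only [List.map_cons, List.reverse_cons, List.prod_append, List.prod_singleton, mul_assoc,
        letter, Sum.elim_inr, ← join_mul, one_mul]
      rw [show (Sum.elim (fun g => join e g 1) fun h => join e 1 h) = letter e from rfl, ih]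
      simp [List.filterMap_cons, mul_assoc]

variable [Fintype A] [DecidableEq A] [Fintype B] [DecidableEq B] [Fintype V] [DecidableEq V]

theorem cycleType_join (g : Perm A) (h : Perm B) :
    (join e g h).cycleType = g.cycleType + h.cycleType := by
  classical
  have hA : Function.Injective (e ∘ Sum.inl) := e.injective.comp Sum.inl_injective
  have hB : Function.Injective (e ∘ Sum.inr) := e.injective.comp Sum.inr_injective
  have h1 : join e g 1 = g.extendDomain (Equiv.ofInjective _ hA) := by
    refine perm_ext_sum e (fun a => ?_) fun b => ?_
    · have := Perm.extendDomain_apply_image g (Equiv.ofInjective _ hA) a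
      rw [join_inl]
      exact this.symm
    · rw [join_inr, Perm.extendDomain_apply_not_subtype]
      · rfl
      · simp
  have h2 : join e 1 h = h.extendDomain (Equiv.ofInjective _ hB) := by
    refine perm_ext_sum e (fun a => ?_) fun b => ?_
    · rw [join_inl, Perm.extendDomain_apply_not_subtype]
      · rfl
      · simp
    · have := Perm.extendDomain_apply_image h (Equiv.ofInjective _ hB) b
      rw [join_inr]
      exact this.symm
  have hdisj : Perm.Disjoint (join e g 1) (join e 1 h) := by
    intro v
    obtain ⟨a | b, rfl⟩ := e.surjective v
    · exact Or.inr (by rw [join_inl]; rfl)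
    · exact Or.inl (by rw [join_inr]; rfl)
  have hmul : join e g h = join e g 1 * join e 1 h := by rw [← join_mul, mul_one, one_mul]
  rw [hmul, hdisj.cycleType_mul, h1, h2, Perm.cycleType_extendDomain, Perm.cycleType_extendDomain]

theorem cycleWeight_join {R : Type*} [CommSemiring R] (P : ℕ → R) (g : Perm A) (h : Perm B) :
    cycleWeight P (join e g h) = cycleWeight P g * cycleWeight P h := by
  have hparts : (join e g h).partition.parts = g.partition.parts + h.partition.parts := by
    rw [Perm.parts_partition, Perm.parts_partition, Perm.parts_partition, ← Perm.sum_cycleType,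
      cycleType_join, Multiset.sum_add, Perm.sum_cycleType, Perm.sum_cycleType,
      ← Fintype.card_congr e, Fintype.card_sum, add_add_add_comm, ← Multiset.replicate_add]
    have h1 := g.support.card_le_univ
    have h2 := h.support.card_le_univ
    congr 2
    omega
  rw [cycleWeight, cycleWeight, cycleWeight, hparts, Multiset.map_add, Multiset.prod_add]

/-- The transpositions that preserve `A` are those of `A` and those of its complement. -/
theorem filter_swaps_eq_image [DecidablePred fun τ : Perm V =>
      ∀ v ∈ Set.range (e ∘ Sum.inl), τ v ∈ Set.range (e ∘ Sum.inl)] :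
    ((swaps V).filter fun τ => ∀ v ∈ Set.range (e ∘ Sum.inl), τ v ∈ Set.range (e ∘ Sum.inl)) =
      ((swaps A).disjSum (swaps B)).image (letter e) := by
  classical
  ext τ
  simp only [mem_filter, mem_image, mem_swaps]
  constructor
  · rintro ⟨⟨x, y, hxy, rfl⟩, hτ⟩
    obtain ⟨x | x, rfl⟩ := e.surjective x <;> obtain ⟨y | y, rfl⟩ := e.surjective y
    · refine ⟨Sum.inl (swap x y), ?_, join_swap_left e x y⟩
      exact inl_mem_disjSum.mpr (mem_swaps.mpr ⟨x, y, fun h => hxy (h ▸ rfl), rfl⟩)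
    · obtain ⟨z, hz⟩ := hτ _ ⟨x, rfl⟩
      simp at hz
    · obtain ⟨z, hz⟩ := hτ _ ⟨y, rfl⟩
      simp at hz
    · refine ⟨Sum.inr (swap x y), ?_, join_swap_right e x y⟩
      exact inr_mem_disjSum.mpr (mem_swaps.mpr ⟨x, y, fun h => hxy (h ▸ rfl), rfl⟩)
  · rintro ⟨l | l, hl, rfl⟩
    · obtain ⟨x, y, hxy, rfl⟩ := mem_swaps.mp (inl_mem_disjSum.mp hl)
      refine ⟨⟨_, _, ?_, join_swap_left e x y⟩, ?_⟩
      · simpa using hxy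
      · rintro _ ⟨a, rfl⟩
        exact ⟨_, (join_inl e _ _ a).symm⟩
    · obtain ⟨x, y, hxy, rfl⟩ := mem_swaps.mp (inr_mem_disjSum.mp hl)
      refine ⟨⟨_, _, ?_, join_swap_right e x y⟩, ?_⟩
      · simpa using hxy
      · rintro _ ⟨a, rfl⟩
        exact ⟨_, (join_inl e _ _ a).symm⟩

end Splitting

/-! ### Shuffles of words -/

section WordSplitting

variable {G H R : Type*} [CommSemiring R]

theorem wordSum_zero {A : Type*} [AddCommMonoid A] (S : Finset G) (r : ℕ) :
    wordSum S r (fun _ => (0 : A)) = 0 := by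
  induction r with
  | zero => rfl
  | succ r ih => exact sum_eq_zero fun g _ => ih

/-- Letters that make the summand vanish can be dropped from the alphabet. -/
theorem wordSum_filter {A : Type*} [AddCommMonoid A] (S : Finset G) (p : G → Prop)
    [DecidablePred p] (r : ℕ) (φ : List G → A) (h : ∀ L, (∃ g ∈ L, ¬ p g) → φ L = 0) :
    wordSum S r φ = wordSum (S.filter p) r φ := by
  induction r generalizing φ with
  | zero => rfl
  | succ r ih =>
    rw [wordSum, wordSum, sum_filter]
    refine sum_congr rfl fun g _ => ?_
    split_ifs with hg
    · exact ih _ fun L ⟨g', hg', hp⟩ => h _ ⟨g', List.mem_cons_of_mem _ hg', hp⟩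
    · rw [← wordSum_zero S r]
      exact wordSum_congr S fun L _ => h _ ⟨g, List.mem_cons_self, hg⟩

theorem wordSum_image {A : Type*} [AddCommMonoid A] [DecidableEq G] (S : Finset H) (f : H → G)
    (hf : Set.InjOn f S) (r : ℕ) (φ : List G → A) :
    wordSum (S.image f) r φ = wordSum S r fun w => φ (w.map f) := by
  induction r generalizing φ with
  | zero => rfl
  | succ r ih =>
    rw [wordSum, wordSum, sum_image hf]
    exact sum_congr rfl fun g _ => ih _

/-- Words in a disjoint union of two alphabets are shuffles. -/
theorem wordSum_disjSum (S : Finset G) (T : Finset H) (r : ℕ) (φ : List G → R) (ψ : List H → R) :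
    wordSum (S.disjSum T) r
      (fun w => φ (w.filterMap Sum.getLeft?) * ψ (w.filterMap Sum.getRight?)) =
      ∑ ij ∈ antidiagonal r, (r.choose ij.1 : R) * (wordSum S ij.1 φ * wordSum T ij.2 ψ) := by
  induction r generalizing φ ψ with
  | zero => simp [wordSum]
  | succ r ih =>
    rw [sum_antidiagonal_choose_succ_mul (fun i j => wordSum S i φ * wordSum T j ψ), wordSum,
      sum_disjSum]
    simp only [List.filterMap_cons, Sum.getLeft?_inl, Sum.getRight?_inl, Sum.getLeft?_inr,
      Sum.getRight?_inr]
    rw [sum_congr rfl fun g _ => ih (fun L => φ (g :: L)) ψ,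
      sum_congr rfl fun h _ => ih φ (fun L => ψ (h :: L)), sum_comm, sum_comm (s := T), add_comm]
    congr 1
    · refine sum_congr rfl fun ij _ => ?_
      rw [← mul_sum, ← mul_sum, wordSum]
    · refine sum_congr rfl fun ij hij => ?_
      rw [← mul_sum, ← sum_mul, wordSum, ← Nat.choose_symm_of_eq_add (mem_antidiagonal.mp hij).symm]

end WordSplitting

/-! ### The exponential formula -/

section Exponential

open scoped Classical in
/-- The sum over all orbits of a base point. -/
theorem sum_isOrbit {V : Type*} [Fintype V] [DecidableEq V] (L : List (Perm V))
    (v₀ : V) {R : Type*}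
    [AddCommMonoid R] (x : R) :
    ∑ S : Finset V with v₀ ∈ S, (if IsOrbit L v₀ (S : Set V) then x else 0) = x := by
  obtain ⟨S, hS, huniq⟩ := existsUnique_isOrbit L v₀
  rw [sum_eq_single_of_mem S.toFinset]
  · rw [if_pos]
    simpa using hS
  · simpa using hS.1
  · intro T _ hT
    refine if_neg fun h => hT ?_
    have := huniq _ h
    simp [← this]

variable {R : Type*} [CommRing R] (P Q : ℕ → R)

/-- The weight of a factorization: `Q` records the cycles of `σ`, and `P` those of the product. -/
def tupleWeight {V : Type*} [Fintype V] [DecidableEq V] (σ : Perm V) (L : List (Perm V)) : R :=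
  cycleWeight Q σ * cycleWeight P (L.reverse.prod * σ)

/-- The weighted number of factorizations with `r` transpositions. -/
noncomputable def allSum (V : Type*) [Fintype V] [DecidableEq V] (r : ℕ) : R :=
  ∑ σ : Perm V, wordSum (swaps V) r fun L => tupleWeight P Q σ L

open scoped Classical in
/-- The weighted number of transitive factorizations with `r` transpositions. -/
noncomputable def connSum (V : Type*) [Fintype V] [DecidableEq V] (r : ℕ) : R :=
  ∑ σ : Perm V, wordSum (swaps V) r fun L =>
    if NoInvariant (σ :: L) then tupleWeight P Q σ L else 0

open scoped Classical in
/-- The factorizations for which the orbit of a base point is a given set `A` consist of a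
transitive factorization on `A` and an arbitrary one on the complement, shuffled together. -/
theorem sum_orbit_eq {A B V : Type*} [Fintype A] [DecidableEq A] [Fintype B] [DecidableEq B]
    [Fintype V] [DecidableEq V] (e : A ⊕ B ≃ V) (a : A) (r : ℕ) :
    (∑ σ : Perm V, wordSum (swaps V) r fun L =>
      if IsOrbit (σ :: L) (e (Sum.inl a)) (Set.range (e ∘ Sum.inl)) then tupleWeight P Q σ L
      else 0) =
    ∑ ij ∈ antidiagonal r, (r.choose ij.1 : R) * (connSum P Q A ij.1 * allSum P Q B ij.2) := by
  have h1 : ∀ (σ : Perm V), σ ∉ (univ.image fun x : Perm A × Perm B => join e x.1 x.2) →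
      (wordSum (swaps V) r fun L =>
      if IsOrbit (σ :: L) (e (Sum.inl a)) (Set.range (e ∘ Sum.inl)) then tupleWeight P Q σ L
      else 0) = 0 := by
    intro σ hσ
    refine (wordSum_congr _ fun L _ => if_neg fun h => hσ ?_).trans (wordSum_zero (swaps V) r)
    obtain ⟨g, g', rfl⟩ := exists_join e σ (h.2.1 σ List.mem_cons_self)
    exact mem_image.mpr ⟨(g, g'), mem_univ _, rfl⟩
  have h2 : ∀ (g : Perm A) (h : Perm B), (wordSum (swaps V) r fun L =>
      if IsOrbit (join e g h :: L) (e (Sum.inl a)) (Set.range (e ∘ Sum.inl)) then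
        tupleWeight P Q (join e g h) L else 0) =
      ∑ ij ∈ antidiagonal r, (r.choose ij.1 : R) *
        ((wordSum (swaps A) ij.1 fun L => if NoInvariant (g :: L) then tupleWeight P Q g L else 0) *
          wordSum (swaps B) ij.2 (tupleWeight P Q h)) := by
    intro g h
    rw [wordSum_filter _ (fun τ => ∀ v ∈ Set.range (e ∘ Sum.inl), τ v ∈ Set.range (e ∘ Sum.inl)),
      filter_swaps_eq_image e, wordSum_image _ _ (letter_injOn e), ← wordSum_disjSum]
    · refine wordSum_congr _ fun w _ => ?_
      rw [ite_mul, zero_mul]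
      refine if_congr (isOrbit_join_iff e w g h a) ?_ rfl
      rw [tupleWeight, tupleWeight, tupleWeight, reverse_prod_letter, cycleWeight_join,
        cycleWeight_join]
      ring
    · rintro L ⟨τ, hτ, hn⟩
      exact if_neg fun h => hn (h.2.1 τ (List.mem_cons_of_mem _ hτ))
  -- Only the permutations `σ` that preserve `A` contribute.
  rw [← sum_subset (subset_univ (univ.image fun x : Perm A × Perm B => join e x.1 x.2))
    (fun σ _ hσ => h1 σ hσ), sum_image (fun x _ y _ h => join_injective e h),
    Fintype.sum_prod_type]
  simp only [h2]
  rw [sum_congr rfl fun g _ => sum_comm, sum_comm]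
  refine sum_congr rfl fun ij _ => ?_
  rw [connSum, allSum, sum_mul_sum, mul_sum]
  refine sum_congr rfl fun g _ => ?_
  rw [mul_sum]

/-- There are `C(n, k)` subsets of size `k + 1` of `{0, …, n}` that contain `0`. -/
theorem sum_finset_zero_mem_card {n : ℕ} {A : Type*} [AddCommMonoid A] (f : ℕ → A) :
    ∑ S : Finset (Fin (n + 1)) with 0 ∈ S, f S.card =
      ∑ k ∈ range (n + 1), n.choose k • f (k + 1) := by
  have h := sum_powerset_apply_card (fun k => f (k + 1)) (x := univ.erase (0 : Fin (n + 1)))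
  rw [card_erase_of_mem (mem_univ _), card_univ, Fintype.card_fin, Nat.add_sub_cancel] at h
  rw [← h]
  refine sum_bij' (fun S _ => S.erase 0) (fun S _ => insert 0 S) ?_ ?_ ?_ ?_ ?_
  · intro S _
    exact mem_powerset.mpr (erase_subset_erase _ (subset_univ S))
  · intro S _
    simp
  · intro S hS
    exact insert_erase (mem_filter.mp hS).2
  · intro S hS
    exact erase_insert fun h => by simpa using mem_powerset.mp hS h
  · intro S hS
    rw [card_erase_add_one (mem_filter.mp hS).2]

/-- The recursion behind the exponential formula: split off the orbit of one point. -/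
theorem allSum_succ (n r : ℕ) :
    allSum P Q (Fin (n + 1)) r = ∑ k ∈ range (n + 1), n.choose k •
      ∑ ij ∈ antidiagonal r, (r.choose ij.1 : R) *
        (connSum P Q (Fin (k + 1)) ij.1 * allSum P Q (Fin (n - k)) ij.2) := by
  classical
  have h1 : allSum P Q (Fin (n + 1)) r = ∑ S : Finset (Fin (n + 1)) with 0 ∈ S,
      ∑ σ : Perm (Fin (n + 1)), wordSum (swaps (Fin (n + 1))) r fun L =>
        if IsOrbit (σ :: L) 0 (S : Set (Fin (n + 1))) then tupleWeight P Q σ L else 0 := by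
    rw [sum_comm, allSum]
    refine sum_congr rfl fun σ _ => ?_
    rw [sum_wordSum]
    exact wordSum_congr _ fun L _ => (sum_isOrbit _ _ _).symm
  have h2 : ∀ S ∈ univ.filter fun S : Finset (Fin (n + 1)) => 0 ∈ S,
      (∑ σ : Perm (Fin (n + 1)), wordSum (swaps (Fin (n + 1))) r fun L =>
        if IsOrbit (σ :: L) 0 (S : Set (Fin (n + 1))) then tupleWeight P Q σ L else 0) =
      ∑ ij ∈ antidiagonal r, (r.choose ij.1 : R) *
        (connSum P Q (Fin S.card) ij.1 * allSum P Q (Fin (n + 1 - S.card)) ij.2) := by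
    intro S hS
    have hcompl : Sᶜ.card = n + 1 - S.card := by rw [card_compl, Fintype.card_fin]
    have hrange : Set.range (finSumEquivOfFinset (s := S) rfl hcompl ∘ Sum.inl) = S := by
      have : finSumEquivOfFinset (s := S) rfl hcompl ∘ Sum.inl = S.orderEmbOfFin rfl :=
        funext fun i => finSumEquivOfFinset_inl _ _ i
      rw [this, range_orderEmbOfFin]
    obtain ⟨a, ha⟩ : (0 : Fin (n + 1)) ∈ Set.range (finSumEquivOfFinset (s := S) rfl hcompl ∘
        Sum.inl) := by
      rw [hrange]
      exact (mem_filter.mp hS).2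
    have := sum_orbit_eq P Q (finSumEquivOfFinset (s := S) rfl hcompl) a r
    rw [← this, hrange, show finSumEquivOfFinset (s := S) rfl hcompl (Sum.inl a) = 0 from ha]
  rw [h1, sum_congr rfl h2, sum_finset_zero_mem_card fun k =>
      ∑ ij ∈ antidiagonal r, (r.choose ij.1 : R) *
        (connSum P Q (Fin k) ij.1 * allSum P Q (Fin (n + 1 - k)) ij.2)]
  refine sum_congr rfl fun k _ => ?_
  rw [Nat.add_sub_add_right]

end Exponential

/-! ### Parity and the Riemann–Hurwitz inequality -/

section Genus

/-- One linear equation lowers the dimension by at most one. -/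
theorem finrank_le_finrank_inf_ker {V : Type*} [Fintype V] (X : Submodule (ZMod 2) (V → ZMod 2))
    (φ : (V → ZMod 2) →ₗ[ZMod 2] ZMod 2) :
    Module.finrank (ZMod 2) X ≤ Module.finrank (ZMod 2) ↥(X ⊓ LinearMap.ker φ) + 1 := by
  have h1 := Submodule.finrank_sup_add_finrank_inf_eq X (LinearMap.ker φ)
  have h2 := Submodule.finrank_le (X ⊔ LinearMap.ker φ)
  have h3 := LinearMap.finrank_range_add_finrank_ker φ
  have h4 := Submodule.finrank_le (LinearMap.range φ)
  rw [Module.finrank_self] at h4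
  omega

variable {V : Type*} [Fintype V] [DecidableEq V]

/-- The number of cycles, fixed points included. -/
def numCycles (σ : Perm V) : ℕ := σ.partition.parts.card

theorem sign_eq_numCycles (σ : Perm V) : Perm.sign σ = (-1) ^ (Fintype.card V + numCycles σ) := by
  have h := σ.support.card_le_univ
  rw [Perm.sign_of_cycleType, numCycles, Perm.parts_partition, Multiset.card_add,
    Multiset.card_replicate, Perm.sum_cycleType]
  have : Fintype.card V + (σ.cycleType.card + (Fintype.card V - σ.support.card)) =
      σ.support.card + σ.cycleType.card + 2 * (Fintype.card V - σ.support.card) := by omega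
  rw [this, pow_add _ _ (2 * _), pow_mul]
  simp

theorem sign_reverse_prod (L : List (Perm V)) (hL : ∀ τ ∈ L, τ.IsSwap) :
    Perm.sign L.reverse.prod = (-1) ^ L.length := by
  induction L with
  | nil => simp
  | cons τ L ih =>
    rw [List.reverse_cons, List.prod_append, List.prod_singleton, Perm.sign_mul,
      ih fun g hg => hL g (List.mem_cons_of_mem _ hg), (hL τ List.mem_cons_self).sign_eq,
      List.length_cons, pow_succ]

theorem neg_one_pow_units_eq_iff (m n : ℕ) : (-1 : ℤˣ) ^ m = (-1) ^ n ↔ m % 2 = n % 2 := by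
  rw [Int.units_pow_eq_pow_mod_two _ m, Int.units_pow_eq_pow_mod_two _ n]
  rcases Nat.mod_two_eq_zero_or_one m with hm | hm <;>
    rcases Nat.mod_two_eq_zero_or_one n with hn | hn <;> rw [hm, hn] <;> decide

/-- Every transposition changes the sign of the product, and hence the parity of the number of
cycles. -/
theorem numCycles_parity (σ : Perm V) (L : List (Perm V)) (hL : ∀ τ ∈ L, τ.IsSwap) :
    numCycles (L.reverse.prod * σ) % 2 = (L.length + numCycles σ) % 2 := by
  have h : Perm.sign (L.reverse.prod * σ) = Perm.sign L.reverse.prod * Perm.sign σ :=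
    Perm.sign_mul _ _
  rw [sign_reverse_prod L hL, sign_eq_numCycles, sign_eq_numCycles, ← pow_add,
    neg_one_pow_units_eq_iff] at h
  omega

/-- The functions `V → 𝔽₂` that are constant on the cycles of all permutations in the list. -/
def invariants (L : List (Perm V)) : Submodule (ZMod 2) (V → ZMod 2) where
  carrier := {f | ∀ g ∈ L, ∀ v, f (g v) = f v}
  add_mem' {f f'} hf hf' g hg v := by rw [Pi.add_apply, Pi.add_apply, hf g hg, hf' g hg]
  zero_mem' _ _ _ := rfl
  smul_mem' c f hf g hg v := by rw [Pi.smul_apply, Pi.smul_apply, hf g hg]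

/-- There are `2 ^ c` functions `V → 𝔽₂` that are constant on the `c` cycles. -/
theorem finrank_invariants_singleton (σ : Perm V) :
    Module.finrank (ZMod 2) (invariants [σ]) = numCycles σ := by
  classical
  have h1 : Fintype.card (invariants [σ]) = 2 ^ numCycles σ := by
    have h := cycleWeight_powerSum (fun _ : ZMod 2 => (1 : ℕ)) σ
    simp only [one_pow, prod_const_one, sum_const, card_univ, ZMod.card, smul_eq_mul, mul_one,
      cycleWeight, Multiset.map_const', Multiset.prod_replicate] at h
    rw [numCycles, h, Fintype.card_subtype]
    congr 1
    refine filter_congr fun f _ => ?_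
    rw [funext_iff]
    simp [invariants]
  have h2 := Module.card_eq_pow_finrank (K := ZMod 2) (V := invariants [σ])
  rw [h1, ZMod.card] at h2
  exact (Nat.pow_right_injective le_rfl h2).symm

/-- The Riemann-Hurwitz inequality. Every transposition either joins two orbits of the group
generated so far, and then also two cycles of the product, or changes the number of cycles of the
product by one. -/
theorem numCycles_add_numCycles_le (σ : Perm V) (L : List (Perm V)) (hL : ∀ τ ∈ L, τ.IsSwap) :
    numCycles σ + numCycles (L.reverse.prod * σ) ≤
      L.length + 2 * Module.finrank (ZMod 2) (invariants (σ :: L)) := by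
  induction L using List.reverseRecOn with
  | nil =>
    rw [finrank_invariants_singleton]
    simp
    omega
  | append_singleton L τ ih =>
    have ih := ih fun g hg => hL g (List.mem_append_left _ hg)
    have hτ : τ.IsSwap := hL τ (by simp)
    obtain ⟨a, b, hab, hsw⟩ := id hτ
    set γ := L.reverse.prod * σ with hγ
    have hprod : (L ++ [τ]).reverse.prod * σ = τ * γ := by simp [hγ, mul_assoc]
    set φ : (V → ZMod 2) →ₗ[ZMod 2] ZMod 2 :=
      LinearMap.proj (R := ZMod 2) (φ := fun _ : V => ZMod 2) a -
        LinearMap.proj (R := ZMod 2) (φ := fun _ : V => ZMod 2) b with hφ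
    have hker : ∀ f : V → ZMod 2, f ∈ LinearMap.ker φ ↔ ∀ v, f (τ v) = f v := by
      intro f
      rw [LinearMap.mem_ker, hφ, LinearMap.sub_apply, LinearMap.proj_apply, LinearMap.proj_apply,
        sub_eq_zero, hsw]
      constructor
      · intro h v
        rw [swap_apply_def]
        split_ifs with h1 h2
        · rw [h1, h]
        · rw [h2, h]
        · rfl
      · intro h
        have := h b
        rwa [swap_apply_right] at this
    have hW : invariants (σ :: (L ++ [τ])) = invariants (σ :: L) ⊓ LinearMap.ker φ := by
      ext f
      rw [Submodule.mem_inf, hker]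
      simp only [invariants, Submodule.mem_mk, AddSubmonoid.mem_mk, AddSubsemigroup.mem_mk,
        Set.mem_ofPred_eq, List.mem_cons, List.mem_append, List.not_mem_nil, or_false]
      constructor
      · exact fun h => ⟨fun g hg => h g (by tauto), h τ (by tauto)⟩
      · rintro ⟨h1, h2⟩ g (hg | hg | rfl)
        · exact h1 g (Or.inl hg)
        · exact h1 g (Or.inr hg)
        · exact h2
    have hU : invariants [τ * γ] ⊓ LinearMap.ker φ = invariants [γ] ⊓ LinearMap.ker φ := by
      ext f
      rw [Submodule.mem_inf, Submodule.mem_inf, hker, and_congr_left_iff]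
      intro hf
      simp [invariants, hf]
    have hWU : invariants (σ :: L) ≤ invariants [γ] := by
      intro f hf
      have hmem : ∀ L' : List (Perm V), (∀ g ∈ L', ∀ v, f (g v) = f v) → ∀ v,
          f (L'.prod v) = f v := by
        intro L'
        induction L' with
        | nil => simp
        | cons g L' ih' =>
          intro h v
          rw [List.prod_cons, Perm.mul_apply, h g List.mem_cons_self,
            ih' fun g' hg' => h g' (List.mem_cons_of_mem _ hg')]
      intro g hg v
      obtain rfl : g = γ := by simpa using hg
      rw [hγ, Perm.mul_apply, hmem _ fun g hg => hf g (by simp at hg; simp [hg])]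
      exact hf σ List.mem_cons_self v
    have hc' := finrank_le_finrank_inf_ker (invariants [τ * γ]) φ
    have hw' := finrank_le_finrank_inf_ker (invariants (σ :: L)) φ
    rw [hU, finrank_invariants_singleton] at hc'
    rw [hprod, hW, List.length_append, List.length_singleton]
    -- If `τ` lies in one orbit of the group generated so far, the invariants do not change, and
    -- the number of cycles grows by at most one. Otherwise the invariants drop by one, and so
    -- does the number of cycles.
    by_cases hle : invariants (σ :: L) ≤ LinearMap.ker φ
    · have h1 := Submodule.finrank_mono (inf_le_left : invariants [γ] ⊓ LinearMap.ker φ ≤ _)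
      rw [finrank_invariants_singleton] at h1
      rw [inf_eq_left.mpr hle]
      omega
    · have hlt : invariants [γ] ⊓ LinearMap.ker φ < invariants [γ] :=
        lt_of_le_of_ne inf_le_left fun h => hle (hWU.trans (inf_eq_left.mp h))
      have h1 := Submodule.finrank_lt_finrank_of_lt hlt
      rw [finrank_invariants_singleton] at h1
      -- The number of cycles cannot stay the same, because the sign changes.
      have h2 := numCycles_parity γ [τ] (by simpa using hτ)
      simp only [List.reverse_singleton, List.prod_singleton, List.length_singleton] at h2
      omega

/-- For a transitive group the invariants are the constant functions. -/
theorem numCycles_add_le_of_noInvariant [Nonempty V] (σ : Perm V) (L : List (Perm V))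
    (hL : ∀ τ ∈ L, τ.IsSwap) (h : NoInvariant (σ :: L)) :
    numCycles σ + numCycles (L.reverse.prod * σ) ≤ L.length + 2 := by
  have h1 := numCycles_add_numCycles_le σ L hL
  have h2 : Module.finrank (ZMod 2) (invariants (σ :: L)) ≤ 1 := by
    obtain ⟨v₀⟩ := ‹Nonempty V›
    have hle : invariants (σ :: L) ≤ Submodule.span (ZMod 2) {fun _ => 1} := by
      intro f hf
      have := h {v | f v = f v₀} ⟨v₀, rfl⟩ fun g hg v hv => (hf g hg v).trans hv
      rw [Submodule.mem_span_singleton]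
      refine ⟨f v₀, funext fun v => ?_⟩
      have : f v = f v₀ := Set.eq_univ_iff_forall.mp this v
      simp [this]
    refine (Submodule.finrank_mono hle).trans ?_
    exact (finrank_span_le_card _).trans (by simp)
  omega

theorem isTransitive_iff_noInvariant {d r : ℕ} (σ : Perm (Fin d)) (τ : Fin r → Perm (Fin d)) :
    IsTransitive σ τ ↔ NoInvariant (σ :: List.ofFn τ) := by
  have hmem : ∀ g, g ∈ insert σ (Set.range τ) ↔ g ∈ σ :: List.ofFn τ := by
    intro g
    simp [List.mem_ofFn, eq_comm]
  constructor
  · intro h T hne hT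
    obtain ⟨t, ht⟩ := hne
    have key : ∀ g ∈ Subgroup.closure (insert σ (Set.range τ)), ∀ v, v ∈ T ↔ g v ∈ T := by
      intro g hg
      induction hg using Subgroup.closure_induction with
      | mem g hg =>
        intro v
        have hg' := (hmem g).mp hg
        exact ⟨hT g hg' v, fun hv => by_contra fun hn => hT.compl g hg' v hn hv⟩
      | one => simp
      | mul g g' _ _ ih ih' =>
        intro v
        rw [Perm.mul_apply, ← ih, ih']
      | inv g _ ih =>
        intro v
        rw [ih (g⁻¹ v)]
        simp
    rw [Set.eq_univ_iff_forall]
    intro v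
    obtain ⟨⟨g, hg⟩, hgt⟩ := h.exists_smul_eq t v
    rw [← hgt]
    exact (key g hg t).mp ht
  · intro h
    refine ⟨fun x y => ?_⟩
    have := h (MulAction.orbit (Subgroup.closure (insert σ (Set.range τ))) x)
      ⟨x, MulAction.mem_orbit_self x⟩ ?_
    · exact (Set.eq_univ_iff_forall.mp this y)
    · rintro g hg _ ⟨k, rfl⟩
      exact ⟨⟨g, Subgroup.subset_closure ((hmem g).mpr hg)⟩ * k, by simp [mul_smul]⟩

end Genus

/-! ### Weighted counts in terms of cycle types -/

section WeightedCounts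

variable {R : Type*} [CommRing R] [Algebra ℚ R] (P Q : ℕ → R)

/-- The monomial `P_α Q_β`. -/
def monomialPQ {d : ℕ} (P Q : ℕ → R) (α β : d.Partition) : R :=
  (α.parts.map P).prod * (β.parts.map Q).prod

/-- The sum of the weights over factorizations, sorted by the cycle types of `σ` and the product. -/
theorem sum_wordSum_tupleWeight {d : ℕ} (r : ℕ)
    (C : Perm (Fin d) → List (Perm (Fin d)) → Prop) [∀ σ L, Decidable (C σ L)] :
    (∑ σ : Perm (Fin d), wordSum (swaps (Fin d)) r fun L =>
      if C σ L then tupleWeight P Q σ L else 0) =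
    ∑ α : d.Partition, ∑ β : d.Partition,
      (Nat.card {x : Perm (Fin d) × (Fin r → Perm (Fin d)) × Perm (Fin d) //
        IsFactorization α β x.1 x.2.1 x.2.2 ∧ C x.1 (List.ofFn x.2.1)} : ℚ) •
        monomialPQ P Q α β := by
  have h1 : ∀ (σ : Perm (Fin d)) (L : List (Perm (Fin d))),
      (if C σ L then tupleWeight P Q σ L else 0) =
      ∑ α : d.Partition, ∑ β : d.Partition, (if σ.partition.parts = β.parts then
        (if (L.reverse.prod * σ).partition.parts = α.parts ∧ C σ L then (1 : ℚ) else 0) else 0) •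
          monomialPQ P Q α β := by
    intro σ L
    obtain ⟨β, hβ⟩ := exists_partition_eq σ
    obtain ⟨α, hα⟩ := exists_partition_eq (L.reverse.prod * σ)
    rw [sum_eq_single α, sum_eq_single β]
    · rw [if_pos hβ, tupleWeight, cycleWeight, cycleWeight, hα, hβ, monomialPQ]
      by_cases h : C σ L
      · simp [h, mul_comm]
      · simp [h]
    · intro β' _ hne
      rw [if_neg, zero_smul]
      exact fun h => hne (Nat.Partition.ext (h.symm.trans hβ))
    · simp
    · intro α' _ hne
      refine sum_eq_zero fun β' _ => ?_
      have : ¬ ((L.reverse.prod * σ).partition.parts = α'.parts ∧ C σ L) :=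
        fun h => hne (Nat.Partition.ext (h.1.symm.trans hα))
      rw [if_neg this, ite_self, zero_smul]
    · simp
  simp only [h1]
  rw [sum_congr rfl fun σ _ => (sum_wordSum _ _ _ _).symm, sum_comm]
  refine sum_congr rfl fun α _ => ?_
  rw [sum_congr rfl fun σ _ => (sum_wordSum _ _ _ _).symm, sum_comm]
  refine sum_congr rfl fun β _ => ?_
  rw [card_eq_wordSum, sum_smul]
  refine sum_congr rfl fun σ _ => ?_
  have h2 := map_wordSum (LinearMap.toSpanSingleton ℚ R (monomialPQ P Q α β)) (swaps (Fin d)) r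
    fun L => if σ.partition.parts = β.parts then
        (if (L.reverse.prod * σ).partition.parts = α.parts ∧ C σ L then (1 : ℚ) else 0) else 0
  simp only [LinearMap.toSpanSingleton_apply] at h2
  rw [← h2]
  congr 1
  split_ifs with h
  · rfl
  · exact wordSum_zero _ _

theorem allSum_eq (d r : ℕ) : allSum P Q (Fin d) r =
    ∑ α : d.Partition, ∑ β : d.Partition,
      (factorizationCount r α β : ℚ) • monomialPQ P Q α β := by
  have := sum_wordSum_tupleWeight P Q (d := d) r fun _ _ => True
  simp only [if_true, and_true] at this
  exact this

theorem connSum_eq (d r : ℕ) : connSum P Q (Fin d) r =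
    ∑ α : d.Partition, ∑ β : d.Partition,
      (transitiveCount r α β : ℚ) • monomialPQ P Q α β := by
  classical
  have := sum_wordSum_tupleWeight P Q (d := d) r fun σ L => NoInvariant (σ :: L)
  simp only [← isTransitive_iff_noInvariant] at this
  rw [connSum]
  convert this using 1
  rfl

end WeightedCounts

/-! ### Exponential generating functions of the counts -/

section GeneratingFunctions

/-- The polynomials in the `pᵢ, qᵢ, u` over the power series in `t`. -/
abbrev TaylorCoeffs : Type := MvPolynomial Var (PowerSeries ℚ)

/-- The weight `pₖ` of a cycle of the product. -/
noncomputable def varP (R : Type*) [CommSemiring R] (k : ℕ) : MvPolynomial Var R :=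
  MvPolynomial.X (Var.p k)

/-- The weight `qₖ u` of a cycle of the initial permutation. -/
noncomputable def varQ (R : Type*) [CommSemiring R] (k : ℕ) : MvPolynomial Var R :=
  MvPolynomial.X (Var.q k) * MvPolynomial.X Var.u

/-- The exponential generating function, in the number of transpositions, of a count indexed by
two partitions of `d`. -/
noncomputable def egf {d : ℕ} (c : ℕ → d.Partition → d.Partition → ℚ) : TaylorCoeffs :=
  ∑ α : d.Partition, ∑ β : d.Partition,
    MvPolynomial.C (PowerSeries.mk fun r => c r α β / (r.factorial * d.factorial)) *
      monomialPQ (varP (PowerSeries ℚ)) (varQ (PowerSeries ℚ)) α β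

/-- The exponential generating function of all factorizations in `S_d`. -/
noncomputable def discEgf (d : ℕ) : TaylorCoeffs :=
  egf fun r (α β : d.Partition) => factorizationCount r α β

/-- The exponential generating function of the transitive factorizations in `S_d`. -/
noncomputable def connEgf (d : ℕ) : TaylorCoeffs :=
  egf fun r (α β : d.Partition) => transitiveCount r α β

/-- The embedding of polynomials over power series into power series over polynomials, where an
identity can be checked for each number of transpositions separately. -/
noncomputable def toSeries : TaylorCoeffs →+* PowerSeries (MvPolynomial Var ℚ) :=
  MvPolynomial.eval₂Hom (PowerSeries.map MvPolynomial.C) fun v =>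
    PowerSeries.C (MvPolynomial.X v)

theorem toSeries_monomial (f : PowerSeries ℚ) (m : Var →₀ ℕ) :
    toSeries (MvPolynomial.monomial m f) =
      PowerSeries.map MvPolynomial.C f * PowerSeries.C (MvPolynomial.monomial m 1) := by
  rw [toSeries, MvPolynomial.coe_eval₂Hom, MvPolynomial.eval₂_monomial, MvPolynomial.monomial_eq,
    map_one, one_mul, Finsupp.prod, Finsupp.prod, map_prod]
  simp

theorem coeff_coeff_toSeries (f : TaylorCoeffs) (m : Var →₀ ℕ) (r : ℕ) :
    (PowerSeries.coeff r (toSeries f)).coeff m = PowerSeries.coeff r (f.coeff m) := by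
  classical
  induction f using MvPolynomial.induction_on' with
  | monomial k c =>
    rw [toSeries_monomial, PowerSeries.coeff_mul_C, PowerSeries.coeff_map,
      MvPolynomial.coeff_C_mul, MvPolynomial.coeff_monomial, MvPolynomial.coeff_monomial]
    split_ifs <;> simp
  | add p q hp hq => simp [map_add, MvPolynomial.coeff_add, hp, hq]

theorem toSeries_injective : Function.Injective toSeries := by
  intro f g h
  ext m r
  rw [← coeff_coeff_toSeries, h, coeff_coeff_toSeries]

theorem toSeries_monomialPQ {d : ℕ} (α β : d.Partition) :
    toSeries (monomialPQ (varP (PowerSeries ℚ)) (varQ (PowerSeries ℚ)) α β) =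
      PowerSeries.C (monomialPQ (varP ℚ) (varQ ℚ) α β) := by
  simp only [monomialPQ, map_mul, map_multiset_prod, Multiset.map_map]
  congr 3 <;> · funext k; simp [toSeries, varP, varQ]

theorem coeff_toSeries_egf {d : ℕ} (c : ℕ → d.Partition → d.Partition → ℚ) (r : ℕ) :
    PowerSeries.coeff r (toSeries (egf c)) = ((r.factorial * d.factorial : ℚ)⁻¹) •
      ∑ α : d.Partition, ∑ β : d.Partition, c r α β • monomialPQ (varP ℚ) (varQ ℚ) α β := by
  simp only [egf, map_sum, smul_sum]
  refine sum_congr rfl fun α _ => sum_congr rfl fun β _ => ?_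
  have : toSeries (MvPolynomial.C (PowerSeries.mk fun r => c r α β /
      (r.factorial * d.factorial))) = PowerSeries.map MvPolynomial.C
        (PowerSeries.mk fun r => c r α β / (r.factorial * d.factorial)) := by
    simp [toSeries]
  rw [map_mul, toSeries_monomialPQ, this, PowerSeries.coeff_mul_C, PowerSeries.coeff_map,
    PowerSeries.coeff_mk, smul_smul, MvPolynomial.smul_eq_C_mul]
  congr 2
  rw [div_eq_inv_mul]

/-- The differential equation `Z' = H' Z` of the exponential formula, coefficientwise. -/
theorem succ_mul_discEgf (n : ℕ) : ((n + 1 : ℕ) : TaylorCoeffs) * discEgf (n + 1) =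
    ∑ k ∈ range (n + 1), ((k + 1 : ℕ) : TaylorCoeffs) * (connEgf (k + 1) * discEgf (n - k)) := by
  apply toSeries_injective
  ext1 r
  have hn : ∀ (m : ℕ) (F : PowerSeries (MvPolynomial Var ℚ)),
      PowerSeries.coeff r ((m : PowerSeries (MvPolynomial Var ℚ)) * F) =
        (m : ℚ) • PowerSeries.coeff r F := by
    intro m F
    rw [← nsmul_eq_mul, map_nsmul, Nat.cast_smul_eq_nsmul]
  have h1 : ∀ d i, PowerSeries.coeff i (toSeries (discEgf d)) =
      ((i.factorial * d.factorial : ℚ)⁻¹) • allSum (varP ℚ) (varQ ℚ) (Fin d) i := by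
    intro d i
    rw [discEgf, coeff_toSeries_egf, allSum_eq]
  have h2 : ∀ d i, PowerSeries.coeff i (toSeries (connEgf d)) =
      ((i.factorial * d.factorial : ℚ)⁻¹) • connSum (varP ℚ) (varQ ℚ) (Fin d) i := by
    intro d i
    rw [connEgf, coeff_toSeries_egf, connSum_eq]
  rw [map_mul, map_natCast, hn, h1, allSum_succ, map_sum, map_sum, smul_sum, smul_sum]
  refine sum_congr rfl fun k hk => ?_
  rw [map_mul, map_natCast, hn, map_mul, PowerSeries.coeff_mul, smul_sum, smul_sum, smul_sum,
    smul_sum]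
  refine sum_congr rfl fun ij hij => ?_
  have hk' : k ≤ n := Nat.lt_succ_iff.mp (mem_range.mp hk)
  have hcast : ∀ (m : ℕ) (F : MvPolynomial Var ℚ), (m : MvPolynomial Var ℚ) * F = (m : ℚ) • F :=
    fun m F => by rw [Nat.cast_smul_eq_nsmul, nsmul_eq_mul]
  rw [h1, h2, smul_mul_smul_comm, ← Nat.cast_smul_eq_nsmul ℚ, hcast, smul_smul, smul_smul,
    smul_smul, smul_smul]
  refine congrArg₂ (· • ·) ?_ rfl
  rw [← mem_antidiagonal.mp hij, Nat.cast_choose ℚ hk', Nat.cast_add_choose]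
  have e1 := Nat.factorial_ne_zero k
  have e2 := Nat.factorial_ne_zero (n - k)
  have e3 := Nat.factorial_ne_zero n
  have e4 := Nat.factorial_ne_zero ij.1
  have e5 := Nat.factorial_ne_zero ij.2
  have e6 := Nat.factorial_ne_zero (ij.1 + ij.2)
  rw [Nat.factorial_succ n, Nat.factorial_succ k]
  push_cast
  field_simp

end GeneratingFunctions

/-! ### Logarithms of power series -/

section Logarithm

variable {A : Type*} [CommRing A] [Algebra ℚ A]

/-- A power series `h` without constant term such that `F' = h' F` is the logarithm of `F`. -/
theorem eq_logOf_of_derivative (F h : PowerSeries A)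
    (hF : PowerSeries.constantCoeff F = 1) (hh : PowerSeries.constantCoeff h = 0)
    (hD : PowerSeries.derivative A F = PowerSeries.derivative A h * F) :
    h = PowerSeries.logOf F := by
  have : IsAddTorsionFree A := .of_module_rat A
  have hsub : PowerSeries.HasSubst (F - 1) :=
    PowerSeries.HasSubst.of_constantCoeff_zero' (by rw [map_sub, hF, map_one, sub_self])
  refine PowerSeries.derivative.ext ?_ (by rw [hh, PowerSeries.constantCoeff_logOf hF])
  set G : PowerSeries A := PowerSeries.mk fun n => algebraMap ℚ A ((-1 : ℚ) ^ n) with hG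
  have h1 : (1 + PowerSeries.X) * G = 1 := by
    ext n
    rw [add_mul, one_mul, map_add, hG]
    cases n with
    | zero => simp
    | succ n =>
      rw [PowerSeries.coeff_succ_X_mul, PowerSeries.coeff_mk, PowerSeries.coeff_mk,
        PowerSeries.coeff_one, if_neg (Nat.succ_ne_zero n), ← map_add, pow_succ]
      simp
  have h2 : F * G.subst (F - 1) = 1 := by
    have := congrArg (PowerSeries.substAlgHom hsub) h1
    rw [map_mul, map_add, map_one, PowerSeries.coe_substAlgHom, PowerSeries.subst_X hsub] at this
    rwa [add_sub_cancel] at this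
  rw [PowerSeries.logOf_eq, PowerSeries.derivative_subst hsub, PowerSeries.deriv_log, map_sub,
    hD, ← hG]
  have h3 : PowerSeries.derivative A (1 : PowerSeries A) = 0 := by simp
  rw [h3, sub_zero, mul_comm, mul_assoc, h2, mul_one]

end Logarithm

/-! ### From Taylor series to Laurent series -/

section Laurent

/-- The passage from Taylor to Laurent series in `t`, with `pᵢ` and `qᵢ` scaled by `t⁻¹`. -/
noncomputable def toLaurent : TaylorCoeffs →+* Coeffs :=
  MvPolynomial.eval₂Hom (MvPolynomial.C.comp (HahnSeries.ofPowerSeries ℤ ℚ)) fun v =>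
    match v with
    | Var.p i => MvPolynomial.X (Var.p i) * tPow (-1)
    | Var.q i => MvPolynomial.X (Var.q i) * tPow (-1)
    | Var.u => MvPolynomial.X Var.u

theorem tPow_add (k l : ℤ) : tPow (k + l) = tPow k * tPow l := by
  rw [tPow, tPow, tPow, ← MvPolynomial.C_mul, HahnSeries.single_mul_single, one_mul]

theorem tPow_zero : tPow 0 = 1 := by
  rw [tPow, ← MvPolynomial.C_1]
  rfl

theorem tPow_neg_one_pow (n : ℕ) : tPow (-1) ^ n = tPow (-n) := by
  induction n with
  | zero => simp [tPow_zero]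
  | succ n ih =>
    rw [pow_succ, ih, ← tPow_add]
    congr 1
    push_cast
    ring

theorem toLaurent_C (f : PowerSeries ℚ) :
    toLaurent (MvPolynomial.C f) = MvPolynomial.C (HahnSeries.ofPowerSeries ℤ ℚ f) := by
  simp [toLaurent]

theorem toLaurent_varP (k : ℕ) :
    toLaurent (varP (PowerSeries ℚ) k) = MvPolynomial.X (Var.p k) * tPow (-1) := by
  simp [toLaurent, varP]

theorem toLaurent_varQ (k : ℕ) : toLaurent (varQ (PowerSeries ℚ) k) =
    MvPolynomial.X (Var.q k) * MvPolynomial.X Var.u * tPow (-1) := by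
  simp [toLaurent, varQ]
  ring

theorem toLaurent_monomialPQ {d : ℕ} (α β : d.Partition) :
    toLaurent (monomialPQ (varP (PowerSeries ℚ)) (varQ (PowerSeries ℚ)) α β) =
      tPow (-(len α + len β)) * monomialPQU α β := by
  have h1 : toLaurent (α.parts.map (varP (PowerSeries ℚ))).prod =
      (α.parts.map fun i => (MvPolynomial.X (Var.p i) : Coeffs)).prod * tPow (-1) ^ len α := by
    rw [map_multiset_prod, Multiset.map_map,
      Multiset.map_congr rfl fun k _ => (Function.comp_apply.trans (toLaurent_varP k)),
      Multiset.prod_map_mul,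
      Multiset.map_const', Multiset.prod_replicate, len]
  have h2 : toLaurent (β.parts.map (varQ (PowerSeries ℚ))).prod =
      (β.parts.map fun i => (MvPolynomial.X (Var.q i) : Coeffs)).prod *
        MvPolynomial.X Var.u ^ len β * tPow (-1) ^ len β := by
    rw [map_multiset_prod, Multiset.map_map,
      Multiset.map_congr rfl fun k _ => (Function.comp_apply.trans (toLaurent_varQ k)),
      Multiset.prod_map_mul,
      Multiset.prod_map_mul, Multiset.map_const', Multiset.map_const', Multiset.prod_replicate,
      Multiset.prod_replicate, len]
  rw [monomialPQ, map_mul, h1, h2, tPow_neg_one_pow, tPow_neg_one_pow, neg_add, tPow_add,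
    monomialPQU]
  ring

theorem laurentSquare_coeff_two_mul (F : LaurentSeries ℚ) (g : ℤ) :
    (laurentSquare F).coeff (2 * g) = F.coeff g :=
  HahnSeries.embDomain_mk_coeff (f := AddMonoidHom.mulLeft (2 : ℤ)) _ _

theorem laurentSquare_coeff_of_odd (F : LaurentSeries ℚ) (m : ℤ) (hm : ¬ 2 ∣ m) :
    (laurentSquare F).coeff m = 0 := by
  refine HahnSeries.embDomain_of_notMem_range ?_
  rintro ⟨g, rfl⟩
  exact hm ⟨g, rfl⟩

/-- Regrouping a series over the genus as a series over the number `r` of transpositions. -/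
theorem laurentSquare_eq {d : ℕ} (α β : d.Partition) (F : LaurentSeries ℚ) (a : ℕ → ℚ)
    (hF : ∀ g, F.coeff g = if 0 ≤ numSimple g α β then a (numSimple g α β).toNat else 0)
    (ha : ∀ r : ℕ, (r + len α + len β) % 2 = 1 → a r = 0) :
    laurentSquare F = HahnSeries.single (2 - (len α + len β) : ℤ) (1 : ℚ) *
      HahnSeries.ofPowerSeries ℤ ℚ (PowerSeries.mk a) := by
  ext m
  rw [HahnSeries.coeff_single_mul, one_mul, PowerSeries.coeff_coe]
  by_cases hm : 2 ∣ m
  · obtain ⟨g, rfl⟩ := hm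
    rw [laurentSquare_coeff_two_mul, hF]
    have e : 2 * g - (2 - (len α + len β : ℤ)) = numSimple g α β := by
      rw [numSimple]
      ring
    rw [e]
    by_cases h : 0 ≤ numSimple g α β
    · rw [if_pos h, if_neg (not_lt.mpr h), PowerSeries.coeff_mk]
      congr 1
      omega
    · rw [if_neg h, if_pos (not_le.mp h)]
  · rw [laurentSquare_coeff_of_odd F m hm]
    split_ifs with h
    · rfl
    · rw [PowerSeries.coeff_mk, ha]
      omega

end Laurent

/-! ### Comparison of the generating series -/

section Comparison

theorem IsFactorization.parity {d r : ℕ} {α β : d.Partition} {σ γ : Perm (Fin d)}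
    {τ : Fin r → Perm (Fin d)} (h : IsFactorization α β σ τ γ) : (r + len α + len β) % 2 = 0 := by
  obtain ⟨h1, h2, h3, rfl⟩ := h
  have := numCycles_parity σ (List.ofFn τ) (by simpa [List.mem_ofFn] using h3)
  rw [numCycles, numCycles, h1, h2, List.length_ofFn] at this
  rw [len, len]
  omega

theorem factorizationCount_eq_zero {d r : ℕ} (α β : d.Partition)
    (h : (r + len α + len β) % 2 = 1) : factorizationCount r α β = 0 := by
  rw [factorizationCount, Nat.card_eq_zero]
  refine Or.inl ⟨fun x => ?_⟩
  have := IsFactorization.parity x.2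
  omega

theorem transitiveCount_eq_zero {d r : ℕ} (α β : d.Partition)
    (h : (r + len α + len β) % 2 = 1) : transitiveCount r α β = 0 := by
  rw [transitiveCount, Nat.card_eq_zero]
  refine Or.inl ⟨fun x => ?_⟩
  have := IsFactorization.parity x.2.1
  omega

/-- The Riemann–Hurwitz bound: a connected cover has nonnegative genus. -/
theorem transitiveCount_eq_zero_of_lt {d r : ℕ} (hd : d ≠ 0) (α β : d.Partition)
    (h : r + 2 < len α + len β) : transitiveCount r α β = 0 := by
  have : NeZero d := ⟨hd⟩
  rw [transitiveCount, Nat.card_eq_zero]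
  refine Or.inl ⟨fun ⟨⟨σ, τ, γ⟩, ⟨h1, h2, h3, h4⟩, h5⟩ => ?_⟩
  have := numCycles_add_le_of_noInvariant σ (List.ofFn τ) (by simpa [List.mem_ofFn] using h3)
    ((isTransitive_iff_noInvariant σ τ).mp h5)
  dsimp only at h1 h2 h4
  rw [h4, numCycles, numCycles, h1, h2, List.length_ofFn] at this
  rw [len, len] at h
  omega

/-- One term of the Hurwitz series: since `2 g = r + 2 - l(α) - l(β)`, the substitution `y = t²`
turns `y^g` into `t² t^r t^(-l(α)) t^(-l(β))`, and the negative powers are absorbed by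
`toLaurent`. -/
theorem laurentSquare_mul_monomialPQU {d : ℕ} (α β : d.Partition) (F : LaurentSeries ℚ)
    (a : ℕ → ℚ)
    (hF : ∀ g, F.coeff g = if 0 ≤ numSimple g α β then a (numSimple g α β).toNat else 0)
    (ha : ∀ r : ℕ, (r + len α + len β) % 2 = 1 → a r = 0) :
    MvPolynomial.map laurentSquare (MvPolynomial.C F * monomialPQU α β) =
      tPow 2 * toLaurent (MvPolynomial.C (PowerSeries.mk a) *
        monomialPQ (varP (PowerSeries ℚ)) (varQ (PowerSeries ℚ)) α β) := by
  have hmon : MvPolynomial.map laurentSquare (monomialPQU α β) = monomialPQU α β := by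
    simp [monomialPQU, map_multiset_prod, Multiset.map_map]
  rw [map_mul, hmon, MvPolynomial.map_C, laurentSquare_eq α β F a hF ha, MvPolynomial.C_mul,
    map_mul, toLaurent_C, toLaurent_monomialPQ, sub_eq_add_neg]
  have : (MvPolynomial.C (HahnSeries.single (2 + -(len α + len β) : ℤ) (1 : ℚ)) : Coeffs) =
      tPow 2 * tPow (-(len α + len β)) := by
    rw [← tPow_add, tPow]
  rw [this]
  ring

theorem coeff_substSquare_hurwitzDiscSeries (d : ℕ) :
    PowerSeries.coeff d (substSquare hurwitzDiscSeries) = tPow 2 * toLaurent (discEgf d) := by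
  rw [substSquare, PowerSeries.coeff_map, hurwitzDiscSeries, PowerSeries.coeff_mk, discEgf, egf,
    map_sum, map_sum, mul_sum]
  refine sum_congr rfl fun α _ => ?_
  rw [map_sum, map_sum, mul_sum]
  refine sum_congr rfl fun β _ => ?_
  refine laurentSquare_mul_monomialPQU α β _ _ (fun g => ?_) fun r hr => ?_
  · rw [HahnSeries.coeff_ofSuppBddBelow, hurwitzDisc]
    have h1 := (autCard_pos α).ne'
    have h2 := (autCard_pos β).ne'
    split_ifs with h
    · field_simp
    · simp
  · rw [factorizationCount_eq_zero α β hr]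
    simp

theorem coeff_substSquare_hurwitzSeries {d : ℕ} (hd : d ≠ 0) :
    PowerSeries.coeff d (substSquare hurwitzSeries) = tPow 2 * toLaurent (connEgf d) := by
  rw [substSquare, PowerSeries.coeff_map, hurwitzSeries, PowerSeries.coeff_mk, if_neg hd, connEgf,
    egf, map_sum, map_sum, mul_sum]
  refine sum_congr rfl fun α _ => ?_
  rw [map_sum, map_sum, mul_sum]
  refine sum_congr rfl fun β _ => ?_
  refine laurentSquare_mul_monomialPQU α β _ _ (fun g => ?_) fun r hr => ?_
  · rw [PowerSeries.coeff_coe]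
    have h1 := (autCard_pos α).ne'
    have h2 := (autCard_pos β).ne'
    split_ifs with hg h h
    -- In genus `g < 0` there are too few transpositions for a transitive group.
    · rw [transitiveCount_eq_zero_of_lt hd]
      · simp
      · rw [numSimple] at h ⊢
        omega
    · rfl
    · rw [PowerSeries.coeff_mk, show ((g.natAbs : ℕ) : ℤ) = g by omega, hurwitz, if_pos h]
      field_simp
    · rw [PowerSeries.coeff_mk, show ((g.natAbs : ℕ) : ℤ) = g by omega, hurwitz, if_neg h]
      simp
  · rw [transitiveCount_eq_zero α β hr]
    simp

/-- The Frobenius count, summed over the number `r` of transpositions by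
`∑ η^r t^r / r! = e^(η t)`. -/
theorem discEgf_eq_sum_schur (d : ℕ) : discEgf d = ∑ lam : d.Partition,
    MvPolynomial.C (PowerSeries.rescale (eta lam : ℚ) (PowerSeries.exp ℚ)) *
      MvPolynomial.aeval (varP (PowerSeries ℚ)) (schur lam) *
      MvPolynomial.aeval (varQ (PowerSeries ℚ)) (schur lam) := by
  have hmk : ∀ α β : d.Partition, (MvPolynomial.C (PowerSeries.mk fun r =>
      (factorizationCount r α β : ℚ) / (r.factorial * d.factorial)) : TaylorCoeffs) =
      ∑ lam : d.Partition, (((zee α : ℚ)⁻¹ * frob (shifted lam) α) *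
        ((zee β : ℚ)⁻¹ * frob (shifted lam) β)) •
        MvPolynomial.C (PowerSeries.rescale (eta lam : ℚ) (PowerSeries.exp ℚ)) := by
    intro α β
    have : PowerSeries.mk (fun r =>
      (factorizationCount r α β : ℚ) / (r.factorial * d.factorial)) =
      ∑ lam : d.Partition, (((zee α : ℚ)⁻¹ * frob (shifted lam) α) *
        ((zee β : ℚ)⁻¹ * frob (shifted lam) β)) •
        PowerSeries.rescale (eta lam : ℚ) (PowerSeries.exp ℚ) := by
      ext r
      have hd : (d.factorial : ℚ) ≠ 0 := mod_cast Nat.factorial_ne_zero d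
      rw [PowerSeries.coeff_mk, factorizationCount_eq, map_sum, mul_comm (r.factorial : ℚ),
        mul_div_mul_left _ _ hd, sum_div]
      refine sum_congr rfl fun lam _ => ?_
      rw [map_smul, PowerSeries.coeff_rescale, PowerSeries.coeff_exp, smul_eq_mul,
        Algebra.algebraMap_self, RingHom.id_apply]
      ring
    rw [this, map_sum]
    refine sum_congr rfl fun lam _ => ?_
    rw [Algebra.smul_def, Algebra.smul_def, MvPolynomial.C_mul, ← MvPolynomial.algebraMap_eq,
      ← IsScalarTower.algebraMap_apply]
  simp only [discEgf, egf, hmk, aeval_schur]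
  simp only [sum_mul]
  rw [sum_congr rfl fun α _ => sum_comm, sum_comm]
  refine sum_congr rfl fun lam _ => ?_
  rw [mul_assoc, sum_mul_sum, mul_sum]
  refine sum_congr rfl fun α _ => ?_
  rw [mul_sum]
  refine sum_congr rfl fun β _ => ?_
  rw [monomialPQ, smul_mul_smul_comm, mul_smul_comm, smul_mul_assoc]

theorem toLaurent_aeval (P : ℕ → TaylorCoeffs) (f : MvPolynomial ℕ ℚ) :
    toLaurent (MvPolynomial.aeval P f) = MvPolynomial.aeval (fun k => toLaurent (P k)) f := by
  rw [MvPolynomial.aeval_def, MvPolynomial.aeval_def, MvPolynomial.hom_eval₂]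
  exact congrArg (fun g => MvPolynomial.eval₂ g _ _) (Subsingleton.elim _ _)

theorem coeff_Z (d : ℕ) : PowerSeries.coeff d Z = toLaurent (discEgf d) := by
  have h : toLaurent (discEgf d) = ∑ lam : d.Partition, MvPolynomial.C (expT (eta lam))
      * MvPolynomial.aeval (fun k => MvPolynomial.X (Var.p k) * tPow (-1)) (schur lam)
      * MvPolynomial.aeval
          (fun k => MvPolynomial.X (Var.q k) * MvPolynomial.X Var.u * tPow (-1)) (schur lam) := by
    rw [discEgf_eq_sum_schur, map_sum]
    refine sum_congr rfl fun lam _ => ?_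
    rw [map_mul, map_mul, toLaurent_C, toLaurent_aeval, toLaurent_aeval, expT]
    simp only [toLaurent_varP, toLaurent_varQ]
  rw [h, Z, map_add, PowerSeries.coeff_mk, PowerSeries.coeff_one]
  split_ifs with hd
  · subst hd
    -- For `d = 0` the sum over the partitions has one term, which is the constant `1` of `Z`.
    have hs : ∀ lam : Nat.Partition 0, schur lam = 1 := by
      intro lam
      have : (rows lam).length = 0 := by
        rw [rows, Multiset.length_sort, Subsingleton.elim lam default]
        rfl
      have : IsEmpty (Fin (rows lam).length) := by
        rw [this]
        infer_instance
      exact Matrix.det_isEmpty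
    rw [add_zero, Fintype.sum_unique, hs, map_one, map_one, mul_one, mul_one]
    have : eta (default : Nat.Partition 0) = 0 := rfl
    rw [this, expT]
    simp
  · rw [zero_add]

theorem hurwitzSeries_eq :
    substSquare hurwitzSeries = PowerSeries.C (tPow 2) * PowerSeries.logOf Z := by
  rw [← eq_logOf_of_derivative Z (PowerSeries.mk fun d => if d = 0 then 0 else
    toLaurent (connEgf d))]
  · ext1 d
    rw [PowerSeries.coeff_C_mul, PowerSeries.coeff_mk]
    split_ifs with hd
    · rw [hd, substSquare, PowerSeries.coeff_map, hurwitzSeries, PowerSeries.coeff_mk, if_pos rfl,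
        map_zero, mul_zero]
    · exact coeff_substSquare_hurwitzSeries hd
  · simp [Z]
  · simp
  · ext1 n
    rw [PowerSeries.coeff_derivative, coeff_Z, PowerSeries.coeff_mul,
      Finset.Nat.sum_antidiagonal_eq_sum_range_succ_mk]
    have := congrArg toLaurent (succ_mul_discEgf n)
    rw [map_mul, map_natCast, map_sum] at this
    rw [mul_comm, ← Nat.cast_succ, this]
    refine Finset.sum_congr rfl fun k _ => ?_
    rw [PowerSeries.coeff_derivative, coeff_Z, PowerSeries.coeff_mk, if_neg (Nat.succ_ne_zero k),
      map_mul, map_mul, map_natCast]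
    push_cast
    ring

theorem hurwitzDiscSeries_eq :
    substSquare hurwitzDiscSeries = PowerSeries.C (tPow 2) * Z := by
  ext1 d
  rw [coeff_substSquare_hurwitzDiscSeries, PowerSeries.coeff_C_mul, coeff_Z]

end Comparison

end DoubleHurwitz

theorem theorem4p1 :
    DoubleHurwitz.substSquare DoubleHurwitz.hurwitzSeries =
        PowerSeries.C (DoubleHurwitz.tPow 2) * PowerSeries.logOf DoubleHurwitz.Z ∧
      DoubleHurwitz.substSquare DoubleHurwitz.hurwitzDiscSeries =
        PowerSeries.C (DoubleHurwitz.tPow 2) * DoubleHurwitz.Z :=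
  ⟨DoubleHurwitz.hurwitzSeries_eq, DoubleHurwitz.hurwitzDiscSeries_eq⟩
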